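/- For $a,a',b,b',\gamma\in\mathbb C$, $\gamma\ne0,-1,-2,\dots$, let $F_3(a,a',b,b';\gamma;X,Y)$ be Appell's function, i.e. the series $$\sum_{m,n\ge0}\frac{(a)_m(a')_n(b)_m(b')_n}{(\gamma)_{m+n}\,m!\,n!}X^mY^n\qquad(|X|<1,\ |Y|<1)$$ near the origin, continued analytically to $\{|X|<1,\ \operatorname{Re}Y<\tfrac12\}$. For $\operatorname{Re}\gamma>0$ and $x>0$ put $$\bigl(I_{0,-}^{\alpha,\alpha',\beta,\beta',\gamma}f\bigr)(x)=\frac{x^{-\alpha'}}{\Gamma(\gamma)}\int_x^\infty(t-x)^{\gamma-1}t^{-\alpha}F_3\Bigl(\alpha,\alpha',\beta,\beta';\gamma;1-\frac xt,1-\frac tx\Bigr)f(t)\,dt ,$$ and let ${}_pF_q(a_1,\dots,a_p;b_1,\dots,b_q;z)=\sum_{k\ge0}\frac{(a_1)_k\cdots(a_p)_k}{(b_1)_k\cdots(b_q)_k\,k!}z^k$. Let $\alpha,\alpha',\beta,\beta',\gamma,\rho,c\in\mathbb C$ with $\operatorname{Re}\gamma>0$ and $$\operatorname{Re}\rho<1+\min\{\operatorname{Re}(-\beta),\operatorname{Re}(\alpha+\alpha'-\gamma),\operatorname{Re}(\alpha+\beta'-\gamma)\},$$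 and suppose that none of $1-\rho$, $\alpha+\alpha'+\beta'-\gamma-\rho+1$, $\alpha-\beta-\rho+1$ is zero or a negative integer (so that the hypergeometric series below are defined). Then for every $x>0$ the integrals defining the left-hand sides below converge absolutely, and $$\Bigl(I_{0,-}^{\alpha,\alpha',\beta,\beta',\gamma}\,t^{\rho}\sin\frac ct\Bigr)(x)=c\,K\,x^{\rho-\alpha-\alpha'+\gamma-1}\;\Phi\Bigl(-\frac{c^2}{4x^2}\Bigr),\qquad \Bigl(I_{0,-}^{\alpha,\alpha',\beta,\beta',\gamma}\,t^{\rho}\sinh\frac ct\Bigr)(x)=c\,K\,x^{\rho-\alpha-\alpha'+\gamma-1}\;\Phi\Bigl(\frac{c^2}{4x^2}\Bigr),$$ where $$K=\frac{\Gamma(\alpha+\alpha'-\gamma-\rho+1)\,\Gamma(\alpha+\beta'-\gamma-\rho+1)\,\Gamma(-\beta-\rho+1)}{\Gamma(1-\rho)\,\Gamma(\alpha+\alpha'+\beta'-\gamma-\rho+1)\,\Gamma(\alpha-\beta-\rho+1)}$$ and $$\Phi(z)={}_6F_7\left[\begin{array}{c}\frac{\alpha+\alpha'-\gamma-\rho+1}2,\frac{\alpha+\alpha'-\gamma-\rho+2}2,\frac{\alpha+\beta'-\gamma-\rho+1}2,\frac{\alpha+\beta'-\gamma-\rho+2}2,\frac{-\beta-\rho+1}2,\frac{-\beta-\rho+2}2\\[2pt]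 \frac32,\frac{1-\rho}2,\frac{2-\rho}2,\frac{\alpha+\alpha'+\beta'-\gamma-\rho+1}2,\frac{\alpha+\alpha'+\beta'-\gamma-\rho+2}2,\frac{\alpha-\beta-\rho+1}2,\frac{\alpha-\beta-\rho+2}2\end{array}\,\middle|\,z\right].$$ -/

import Mathlib

open MeasureTheory Filter Topology

noncomputable section

/-- The Pochhammer symbol `(a)_k = a (a + 1) ⋯ (a + k - 1)`. -/
def poch (a : ℂ) (k : ℕ) : ℂ := (ascPochhammer ℂ k).eval a

/-- The generalized hypergeometric series `ₚF_q(a₁, …, aₚ; b₁, …, b_q; z)`, the sum over `k` of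
`(a₁)_k ⋯ (aₚ)_k / ((b₁)_k ⋯ (b_q)_k k!) z ^ k`. -/
def genHypergeometric (as bs : List ℂ) (z : ℂ) : ℂ :=
  ∑' k : ℕ, (as.map fun a => poch a k).prod /
    ((bs.map fun b => poch b k).prod * (k.factorial : ℂ)) * z ^ k

/-- Appell's double series `F₃(a, a', b, b'; c; X, Y)`, which converges for `|X| < 1`, `|Y| < 1`. -/
def appellF3Series (a a' b b' c : ℂ) (p : ℂ × ℂ) : ℂ :=
  ∑' k : ℕ × ℕ, poch a k.1 * poch a' k.2 * poch b k.1 * poch b' k.2 /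
    (poch c (k.1 + k.2) * (k.1.factorial : ℂ) * (k.2.factorial : ℂ)) * p.1 ^ k.1 * p.2 ^ k.2

/-- A convex open neighbourhood of the origin to which Appell's series continues analytically. It
contains all the points `(1 - x / t, 1 - t / x)` with `0 < x < t`. -/
def appellF3Domain : Set (ℂ × ℂ) := {p | ‖p.1‖ < 1 ∧ p.2.re < 1 / 2}

/-- `F` is an analytic continuation of Appell's series `F₃` from a neighbourhood of the origin to
`appellF3Domain`. -/
structure IsAppellF3Continuation (a a' b b' c : ℂ) (F : ℂ × ℂ → ℂ) : Prop where
  analytic : AnalyticOnNhd ℂ F appellF3Domain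
  eventuallyEq : F =ᶠ[𝓝 (0, 0)] appellF3Series a a' b b' c

open Classical in
/-- Appell's function `F₃(a, a', b, b'; c; X, Y)`, `c ≠ 0, -1, -2, …`, on `appellF3Domain`: the
value there of the analytic continuation of Appell's series. -/
def appellF3 (a a' b b' c X Y : ℂ) : ℂ :=
  if h : ∃ F : ℂ × ℂ → ℂ, IsAppellF3Continuation a a' b b' c F then h.choose (X, Y) else 0

/-- The continuation is unique, so `appellF3` does not depend on the choice made. -/
theorem IsAppellF3Continuation.appellF3_eq {a a' b b' c : ℂ} {F : ℂ × ℂ → ℂ}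
    (hF : IsAppellF3Continuation a a' b b' c F) {X Y : ℂ} (hXY : (X, Y) ∈ appellF3Domain) :
    appellF3 a a' b b' c X Y = F (X, Y) := by
  have h : ∃ F : ℂ × ℂ → ℂ, IsAppellF3Continuation a a' b b' c F := ⟨F, hF⟩
  have hconv : Convex ℝ appellF3Domain := by
    have h1 : appellF3Domain = Metric.ball (0 : ℂ) 1 ×ˢ {z : ℂ | z.re < 1 / 2} := by
      ext p
      simp [appellF3Domain]
    rw [h1]
    exact (convex_ball _ _).prod (convex_halfSpace_re_lt _)
  have h0 : ((0 : ℂ), (0 : ℂ)) ∈ appellF3Domain := by simp [appellF3Domain]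
  rw [appellF3, dif_pos h]
  exact h.choose_spec.analytic.eqOn_of_preconnected_of_eventuallyEq hF.analytic
    hconv.isPreconnected h0 (h.choose_spec.eventuallyEq.trans hF.eventuallyEq.symm) hXY

/-- The function of `t` under the integral sign of the right Marichev–Saigo–Maeda operator. -/
def msmRightIntegrand (α α' β β' γ : ℂ) (f : ℝ → ℂ) (x t : ℝ) : ℂ :=
  ((t - x : ℝ) : ℂ) ^ (γ - 1) * (t : ℂ) ^ (-α) *
    appellF3 α α' β β' γ (1 - (x : ℂ) / (t : ℂ)) (1 - (t : ℂ) / (x : ℂ)) * f t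

/-- The right Marichev–Saigo–Maeda fractional integral `(I_{0,-}^{α,α',β,β',γ} f)(x)`, for
`Re γ > 0` and `x > 0`. -/
def msmRight (α α' β β' γ : ℂ) (f : ℝ → ℂ) (x : ℝ) : ℂ :=
  (x : ℂ) ^ (-α') / Complex.Gamma γ * ∫ t in Set.Ioi x, msmRightIntegrand α α' β β' γ f x t

end

/-!
The function `t ^ ρ sin (c / t)` is a series of power functions `t ^ (ρ - 2 k - 1)`, so it is enough
to apply the operator to a power function and to justify integrating term by term.

Pfaff's transformation of the inner series of `F₃` in `Y` gives
`F₃(X, Y) = (1 - Y) ^ (-a') ∑ c_{m,n} X ^ m (Y / (Y - 1)) ^ n`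
(`appellF3Pfaff`, with coefficients `pfaffCoeff`), where the double series converges for `|X| < 1`
and `Re Y < 1 / 2`; this is the analytic continuation. At the points `(1 - x / t, 1 - t / x)` which
occur in the operator both variables of the transformed series are equal to `w = 1 - x / t`. The
substitution `t = x / (1 - w)` therefore leads to
`∫₀¹ w ^ (γ - 1) (1 - w) ^ (δ - 1) ∑ c_{m,n} w ^ (m + n) dw` with `δ = α + α' - γ - ρ + 1`.

If `0 < Re a'`, the series of the beta integrals of the terms converges absolutely by the estimate
`exists_norm_poch_div_le` for quotients of Pochhammer symbols, and Gauss's theorem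
(`hasSum_gaussTerm`), applied first to the sum over `n` and then to the sum over `m`, evaluates it
(`integral_pfaffDiag_of_re_pos`). When `a'` and `b'` have negative real parts the double series need
not converge absolutely. The contiguous relation `pfaffDiag_contiguous` then expresses the integral
through two integrals of the same kind with `a' + 1` in place of `a'`, whose parameters satisfy the
same convergence conditions; induction gives the general case (`integral_pfaffDiag`).

Summing over `k` and splitting the symbols `(s)_{2k}` by the duplication formula `poch_two_mul`
produces the series `₆F₇`.
-/

noncomputable section

/-! ### Pochhammer symbols and their growth -/

@[simp] theorem poch_zero (a : ℂ) : poch a 0 = 1 := by simp [poch]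

theorem poch_succ (a : ℂ) (k : ℕ) : poch a (k + 1) = poch a k * (a + k) := by
  simp [poch, ascPochhammer_succ_right]

theorem poch_succ_left (a : ℂ) (k : ℕ) : poch a (k + 1) = a * poch (a + 1) k := by
  simp [poch, ascPochhammer_succ_left, Polynomial.eval_comp]

theorem poch_add (a : ℂ) (m n : ℕ) : poch a (m + n) = poch a m * poch (a + m) n := by
  induction n with
  | zero => simp
  | succ n ih => rw [← add_assoc, poch_succ, ih, poch_succ]; push_cast; ring

theorem poch_one (n : ℕ) : poch 1 n = n.factorial := by
  simp [poch, ascPochhammer_eval_one]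

theorem poch_ne_zero {a : ℂ} (h : ∀ n : ℕ, a ≠ -n) (k : ℕ) : poch a k ≠ 0 := by
  induction k with
  | zero => simp
  | succ k ih =>
    rw [poch_succ]
    exact mul_ne_zero ih fun h0 => h k (eq_neg_of_add_eq_zero_left h0)

theorem ne_neg_nat_of_re_pos {a : ℂ} (h : 0 < a.re) (n : ℕ) : a ≠ -n := by
  rintro rfl
  simp only [Complex.neg_re, Complex.natCast_re] at h
  linarith [n.cast_nonneg (α := ℝ)]

theorem poch_ne_zero_of_re_pos {a : ℂ} (h : 0 < a.re) (k : ℕ) : poch a k ≠ 0 :=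
  poch_ne_zero (ne_neg_nat_of_re_pos h) k

theorem Gamma_add_nat {a : ℂ} (h : ∀ n : ℕ, a ≠ -n) (k : ℕ) :
    Complex.Gamma (a + k) = Complex.Gamma a * poch a k := by
  induction k with
  | zero => simp
  | succ k ih =>
    have h0 : a + k ≠ 0 := fun h0 => h k (eq_neg_of_add_eq_zero_left h0)
    push_cast
    rw [← add_assoc, Complex.Gamma_add_one _ h0, ih, poch_succ]
    ring

theorem norm_one_add_le_exp (z : ℂ) : ‖1 + z‖ ≤ Real.exp (z.re + ‖z‖ ^ 2 / 2) := by
  have h : ‖1 + z‖ ^ 2 ≤ Real.exp (z.re + ‖z‖ ^ 2 / 2) ^ 2 := by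
    rw [← Real.exp_nat_mul]
    have h1 : ‖1 + z‖ ^ 2 = 1 + (2 * z.re + ‖z‖ ^ 2) := by
      rw [Complex.sq_norm, Complex.sq_norm, Complex.normSq_apply, Complex.normSq_apply]
      simp
      ring
    rw [h1, add_comm]
    refine (Real.add_one_le_exp _).trans (Real.exp_le_exp.2 (le_of_eq ?_))
    push_cast
    ring
  exact le_of_sq_le_sq h (Real.exp_pos _).le

theorem norm_add_nat_ge (c : ℂ) (k : ℕ) :
    min 1 c.re * ((k : ℝ) + 1) ≤ ‖c + k‖ := by
  have h1 : (c + k).re ≤ ‖c + k‖ := Complex.re_le_norm _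
  have h2 : min 1 c.re ≤ 1 := min_le_left _ _
  have h3 : min 1 c.re ≤ c.re := min_le_right _ _
  simp only [Complex.add_re, Complex.natCast_re] at h1
  nlinarith [k.cast_nonneg (α := ℝ)]

/-- One factor of a quotient of Pochhammer symbols, compared with the corresponding factor of a
telescoping product of real powers. -/
theorem exists_norm_add_div_le (c z : ℂ) (hc : 0 < c.re) : ∃ D : ℝ, 0 ≤ D ∧ ∀ k : ℕ,
    ‖(c + z + k) / (c + k)‖ ≤
      (((k : ℝ) + 2) / (k + 1)) ^ z.re * Real.exp (D * (1 / ((k : ℝ) + 1) ^ 2)) := by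
  set μ : ℝ := min 1 c.re with hμ
  have hμ0 : 0 < μ := lt_min one_pos hc
  refine ⟨‖z‖ * ‖1 - c‖ / μ + ‖z‖ ^ 2 / (2 * μ ^ 2) + ‖z‖, by positivity, fun k => ?_⟩
  have hk : (0 : ℝ) < (k : ℝ) + 1 := by positivity
  have hck : 0 < ‖c + k‖ := lt_of_lt_of_le (mul_pos hμ0 hk) (norm_add_nat_ge c k)
  have hck0 : c + k ≠ 0 := norm_pos_iff.1 hck
  have hk0 : (k : ℂ) + 1 ≠ 0 := by exact_mod_cast hk.ne'
  have e1 : (c + z + k) / (c + k) = 1 + z / (c + k) := by field_simp; ring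
  have e2 : z / (c + k) = z * (1 - c) / ((c + k) * (k + 1)) + z / ((k : ℂ) + 1) := by
    field_simp; ring
  have hl1 : Real.log ((k + 2) / (k + 1)) ≤ 1 / ((k : ℝ) + 1) := by
    refine (Real.log_le_sub_one_of_pos (by positivity)).trans (le_of_eq ?_)
    field_simp; ring
  have hl2 : 1 / ((k : ℝ) + 1) - 1 / ((k : ℝ) + 1) ^ 2 ≤ Real.log ((k + 2) / (k + 1)) := by
    have := Real.one_sub_inv_le_log_of_pos (x := ((k : ℝ) + 2) / (k + 1)) (by positivity)
    refine le_trans ?_ this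
    rw [inv_div]
    have h2 : 1 - ((k : ℝ) + 1) / (k + 2) = 1 / (k + 2) := by field_simp; ring
    rw [h2, div_sub_div _ _ (by positivity) (by positivity), div_le_div_iff₀ (by positivity)
      (by positivity)]
    nlinarith [k.cast_nonneg (α := ℝ)]
  have hsq : ‖z / (c + k)‖ ^ 2 / 2 ≤ ‖z‖ ^ 2 / (2 * μ ^ 2) * (1 / ((k : ℝ) + 1) ^ 2) := by
    rw [norm_div, div_pow, div_div, div_mul_div_comm, mul_one]
    refine div_le_div_of_nonneg_left (by positivity) (by positivity) ?_
    have := pow_le_pow_left₀ (by positivity) (norm_add_nat_ge c k) 2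
    rw [mul_pow] at this
    linarith
  have hre1 : (z * (1 - c) / ((c + k) * (k + 1))).re ≤
      ‖z‖ * ‖1 - c‖ / μ * (1 / ((k : ℝ) + 1) ^ 2) := by
    refine (Complex.re_le_norm _).trans ?_
    have hk1 : ‖(k : ℂ) + 1‖ = (k : ℝ) + 1 := by
      have : (k : ℂ) + 1 = ((k + 1 : ℕ) : ℂ) := by push_cast; ring
      rw [this, Complex.norm_natCast]; push_cast; ring
    rw [norm_div, norm_mul, norm_mul, hk1, div_mul_div_comm, mul_one]
    refine div_le_div_of_nonneg_left (by positivity) (by positivity) ?_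
    have := mul_le_mul_of_nonneg_right (norm_add_nat_ge c k) hk.le
    linarith
  have hre2 : (z / ((k : ℂ) + 1)).re = z.re * (1 / ((k : ℝ) + 1)) := by
    have : z / ((k : ℂ) + 1) = z * ((1 / ((k : ℝ) + 1) : ℝ) : ℂ) := by push_cast; ring
    rw [this, Complex.re_mul_ofReal]
  have hz : z.re * (1 / ((k : ℝ) + 1)) ≤
      z.re * Real.log ((k + 2) / (k + 1)) + ‖z‖ * (1 / ((k : ℝ) + 1) ^ 2) := by
    have h1 := Complex.abs_re_le_norm z
    have h3 : |z.re * (1 / ((k : ℝ) + 1) - Real.log ((k + 2) / (k + 1)))| ≤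
        ‖z‖ * (1 / ((k : ℝ) + 1) ^ 2) := by
      rw [abs_mul]
      refine mul_le_mul h1 ?_ (abs_nonneg _) (norm_nonneg _)
      rw [abs_of_nonneg (by linarith)]
      linarith
    have h4 := le_abs_self (z.re * (1 / ((k : ℝ) + 1) - Real.log ((k + 2) / (k + 1))))
    linarith [mul_sub z.re (1 / ((k : ℝ) + 1)) (Real.log ((k + 2) / (k + 1)))]
  -- `Re (z / (c + k))` differs from `Re z * log ((k + 2) / (k + 1))` by `O(1 / (k + 1) ^ 2)`.
  rw [e1, Real.rpow_def_of_pos (by positivity), ← Real.exp_add]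
  refine (norm_one_add_le_exp _).trans (Real.exp_le_exp.2 ?_)
  have : (z / (c + k)).re = (z * (1 - c) / ((c + k) * (k + 1))).re + (z / ((k : ℂ) + 1)).re := by
    rw [← Complex.add_re, ← e2]
  rw [this, hre2]
  linarith

/-- A bound, uniform in `m` and `n`, for quotients of Pochhammer symbols: the real powers of the
single factors telescope, and the product of the error factors `exp (D / (k + 1) ^ 2)` is
bounded. -/
theorem exists_norm_poch_div_le (c z : ℂ) (hc : 0 < c.re) : ∃ C : ℝ, 0 < C ∧ ∀ m n : ℕ,
    ‖poch (c + z + m) n / poch (c + m) n‖ ≤ C * (((m + n : ℕ) + 1 : ℝ) / (m + 1)) ^ z.re := by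
  obtain ⟨D, hD, h⟩ := exists_norm_add_div_le c z hc
  have hs : Summable fun k : ℕ => D * (1 / ((k : ℝ) + 1) ^ 2) := by
    refine Summable.mul_left _ ?_
    have := (summable_nat_add_iff 1).2 (Real.summable_one_div_nat_pow.2 one_lt_two)
    simpa using this
  refine ⟨Real.exp (∑' k : ℕ, D * (1 / ((k : ℝ) + 1) ^ 2)), Real.exp_pos _, fun m n => ?_⟩
  have key : ‖poch (c + z + m) n / poch (c + m) n‖ ≤
      Real.exp (∑ k ∈ Finset.range n, D * (1 / (((m + k : ℕ) : ℝ) + 1) ^ 2)) *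
        (((m + n : ℕ) + 1 : ℝ) / (m + 1)) ^ z.re := by
    induction n with
    | zero => simp [div_self (by positivity : (m : ℝ) + 1 ≠ 0)]
    | succ n ih =>
      rw [poch_succ, poch_succ, mul_div_mul_comm, norm_mul, Finset.sum_range_succ, Real.exp_add]
      have h1 := h (m + n)
      have e1 : c + z + m + n = c + z + (m + n : ℕ) := by push_cast; ring
      have e2 : c + m + n = c + (m + n : ℕ) := by push_cast; ring
      have e3 : (((m + (n + 1) : ℕ) : ℝ) + 1) / (m + 1) =
          (((m + n : ℕ) : ℝ) + 1) / (m + 1) * ((((m + n : ℕ) : ℝ) + 2) / ((m + n : ℕ) + 1)) := by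
        have : ((m : ℝ) + n + 1) ≠ 0 := by positivity
        push_cast
        field_simp
        ring
      rw [e1, e2, e3, Real.mul_rpow (by positivity) (by positivity)]
      refine (mul_le_mul ih h1 (norm_nonneg _) (by positivity)).trans (le_of_eq ?_)
      ring
  refine key.trans ?_
  refine mul_le_mul_of_nonneg_right (Real.exp_le_exp.2 ?_) (by positivity)
  have := (hs.comp_injective (add_right_injective m)).sum_le_tsum (Finset.range n)
    (fun k _ => by simp only [Function.comp]; positivity)
  refine this.trans ?_
  exact tsum_comp_le_tsum_of_inj hs (fun k => by positivity) (add_right_injective m)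

theorem exists_norm_poch_div_le' (c d : ℂ) (hc : 0 < c.re) : ∃ C : ℝ, 0 < C ∧ ∀ n : ℕ,
    ‖poch d n / poch c n‖ ≤ C * ((n : ℝ) + 1) ^ (d.re - c.re) := by
  obtain ⟨C, hC, h⟩ := exists_norm_poch_div_le c (d - c) hc
  refine ⟨C, hC, fun n => ?_⟩
  simpa using h 0 n

theorem exists_norm_poch_div_factorial_le (a : ℂ) : ∃ C : ℝ, 0 < C ∧ ∀ n : ℕ,
    ‖poch a n / n.factorial‖ ≤ C * ((n : ℝ) + 1) ^ (a.re - 1) := by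
  obtain ⟨C, hC, h⟩ := exists_norm_poch_div_le' 1 a (by simp)
  refine ⟨C, hC, fun n => ?_⟩
  simpa [poch_one] using h n

/-! ### Gauss's theorem -/

theorem summable_nat_add_one_rpow {s : ℝ} (hs : s < -1) :
    Summable fun n : ℕ => ((n : ℝ) + 1) ^ s := by
  have := (summable_nat_add_iff 1).2 (Real.summable_nat_rpow.2 hs)
  simpa using this

theorem poch_eq_prod (a : ℂ) (n : ℕ) : poch a n = ∏ j ∈ Finset.range n, (a + j) := by
  induction n with
  | zero => simp
  | succ n ih => rw [poch_succ, ih, Finset.prod_range_succ]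

theorem GammaSeq_eq_poch (s : ℂ) (n : ℕ) :
    Complex.GammaSeq s n = (n : ℂ) ^ s * n.factorial / poch s (n + 1) := by
  rw [Complex.GammaSeq, poch_eq_prod]

theorem norm_poch_le_norm_poch_add {c : ℂ} (hc : 0 < c.re) (N n : ℕ) :
    ‖poch c n‖ ≤ ‖poch (c + N) n‖ := by
  rw [poch_eq_prod, poch_eq_prod, norm_prod, norm_prod]
  refine Finset.prod_le_prod (fun _ _ => norm_nonneg _) fun j _ => ?_
  rw [Complex.norm_def, Complex.norm_def]
  refine Real.sqrt_le_sqrt ?_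
  rw [Complex.normSq_apply, Complex.normSq_apply]
  simp only [Complex.add_re, Complex.natCast_re, Complex.add_im, Complex.natCast_im, add_zero]
  have : (0 : ℝ) ≤ N := N.cast_nonneg
  have : (0 : ℝ) ≤ j := j.cast_nonneg
  nlinarith

/-- The terms of the regularized series `₂F₁(a, b; c; 1) / Γ(c)`. The inverse of `Complex.Gamma` is
the entire function `1 / Γ` also at the poles, where `Complex.Gamma` is set to `0`. -/
def gaussTerm (a b c : ℂ) (n : ℕ) : ℂ :=
  poch a n * poch b n / n.factorial * (Complex.Gamma (c + n))⁻¹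

theorem gaussTerm_eq_mul_succ (a b c : ℂ) (n : ℕ) :
    gaussTerm a b c n = (c + n) * gaussTerm a b (c + 1) n := by
  have := Complex.one_div_Gamma_eq_self_mul_one_div_Gamma_add_one (c + n)
  rw [gaussTerm, gaussTerm, this, add_right_comm]
  ring

theorem gaussTerm_eq_of_re_pos (a b : ℂ) {c : ℂ} (hc : 0 < c.re) (n : ℕ) :
    gaussTerm a b c n =
      poch a n / n.factorial * (poch b n / poch c n) * (Complex.Gamma c)⁻¹ := by
  rw [gaussTerm, Gamma_add_nat (ne_neg_nat_of_re_pos hc), mul_inv]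
  ring

/-- The decay of the terms for all `c`; the case of small `Re c` follows from `c + 1`. -/
theorem exists_norm_gaussTerm_le (a b c : ℂ) : ∃ C : ℝ, 0 ≤ C ∧ ∀ n : ℕ,
    ‖gaussTerm a b c n‖ ≤ C * ((n : ℝ) + 1) ^ (-1 - (c - a - b).re) := by
  obtain ⟨M, hM⟩ := exists_nat_gt (-c.re)
  replace hM : 0 < c.re + M := by linarith
  induction M generalizing c with
  | zero =>
    have hc : 0 < c.re := by simpa using hM
    obtain ⟨C, hC, h⟩ := exists_norm_poch_div_factorial_le a
    obtain ⟨C', hC', h'⟩ := exists_norm_poch_div_le' c b hc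
    refine ⟨C * C' * ‖(Complex.Gamma c)⁻¹‖, by positivity, fun n => ?_⟩
    rw [gaussTerm_eq_of_re_pos a b hc, norm_mul, norm_mul]
    have e : -1 - (c - a - b).re = (a.re - 1) + (b.re - c.re) := by
      simp only [Complex.sub_re]; ring
    rw [e, Real.rpow_add (by positivity)]
    calc _ ≤ (C * ((n : ℝ) + 1) ^ (a.re - 1)) * (C' * ((n : ℝ) + 1) ^ (b.re - c.re)) *
          ‖(Complex.Gamma c)⁻¹‖ := by
          gcongr
          · exact h n
          · exact h' n
      _ = _ := by ring
  | succ M ih =>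
    obtain ⟨C, hC, h⟩ := ih (c + 1) (by
      simp only [Complex.add_re, Complex.one_re]; push_cast at hM; linarith)
    refine ⟨(‖c‖ + 1) * C, by positivity, fun n => ?_⟩
    rw [gaussTerm_eq_mul_succ, norm_mul]
    have h1 : ‖c + n‖ ≤ (‖c‖ + 1) * ((n : ℝ) + 1) := by
      refine (norm_add_le _ _).trans ?_
      rw [Complex.norm_natCast]
      nlinarith [norm_nonneg c, n.cast_nonneg (α := ℝ),
        mul_nonneg (norm_nonneg c) (n.cast_nonneg (α := ℝ))]
    have e : -1 - (c - a - b).re = 1 + (-1 - (c + 1 - a - b).re) := by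
      simp only [Complex.sub_re, Complex.add_re, Complex.one_re]; ring
    rw [e, Real.rpow_add (by positivity), Real.rpow_one]
    calc _ ≤ ((‖c‖ + 1) * ((n : ℝ) + 1)) * (C * ((n : ℝ) + 1) ^ (-1 - (c + 1 - a - b).re)) := by
          gcongr
          exact h n
      _ = _ := by ring

theorem summable_gaussTerm {a b c : ℂ} (h : 0 < (c - a - b).re) : Summable (gaussTerm a b c) := by
  obtain ⟨C, -, hC⟩ := exists_norm_gaussTerm_le a b c
  exact Summable.of_norm_bounded ((summable_nat_add_one_rpow (by linarith)).mul_left C) hC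

/-- The contiguous relation `(c - a - b) f(c) = (c - a) (c - b) f(c + 1)` for
`f(c) = ₂F₁(a, b; c; 1) / Γ(c)`: the difference of the two sides telescopes. -/
theorem tsum_gaussTerm_contiguous {a b c : ℂ} (h : 0 < (c - a - b).re) :
    (c - a - b) * ∑' n, gaussTerm a b c n =
      (c - a) * (c - b) * ∑' n, gaussTerm a b (c + 1) n := by
  have h' : 0 < (c + 1 - a - b).re := by
    simp only [Complex.sub_re, Complex.add_re, Complex.one_re] at h ⊢; linarith
  have hd := ((summable_gaussTerm h).hasSum.mul_left (c - a - b)).sub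
    ((summable_gaussTerm h').hasSum.mul_left ((c - a) * (c - b)))
  -- The difference of the terms is `u n - u (n + 1)` with `u n = n * gaussTerm a b c n`.
  let u : ℕ → ℂ := fun n => n * gaussTerm a b c n
  have hu : ∀ n, (c - a - b) * gaussTerm a b c n - (c - a) * (c - b) * gaussTerm a b (c + 1) n =
      u n - u (n + 1) := by
    intro n
    have h2 : gaussTerm a b c (n + 1) * ((n : ℂ) + 1) =
        (a + n) * (b + n) * gaussTerm a b (c + 1) n := by
      have h3 : ((n : ℂ) + 1) ≠ 0 := by exact_mod_cast n.succ_ne_zero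
      have h4 : (n.factorial : ℂ) ≠ 0 := by exact_mod_cast n.factorial_ne_zero
      have h5 : c + ((n + 1 : ℕ) : ℂ) = c + 1 + n := by push_cast; ring
      rw [gaussTerm, gaussTerm, poch_succ, poch_succ, Nat.factorial_succ, h5]
      push_cast
      field_simp
    simp only [u]
    push_cast
    rw [mul_comm ((n : ℂ) + 1), h2, gaussTerm_eq_mul_succ]
    ring
  have ht : Tendsto (fun N => ∑ n ∈ Finset.range N, (u n - u (n + 1))) atTop (𝓝 0) := by
    simp_rw [Finset.sum_range_sub']
    have hu0 : Tendsto u atTop (𝓝 0) := by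
      obtain ⟨C, hC, hb⟩ := exists_norm_gaussTerm_le a b c
      have h1 : Tendsto (fun n : ℕ => C * ((n : ℝ) + 1) ^ (-(c - a - b).re)) atTop (𝓝 (C * 0)) :=
        ((tendsto_rpow_neg_atTop h).comp
          (tendsto_atTop_add_const_right _ 1 tendsto_natCast_atTop_atTop)).const_mul C
      rw [mul_zero] at h1
      refine squeeze_zero_norm (fun n => ?_) h1
      simp only [u, norm_mul, Complex.norm_natCast]
      have e : -(c - a - b).re = 1 + (-1 - (c - a - b).re) := by ring
      rw [e, Real.rpow_add (by positivity), Real.rpow_one]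
      calc _ ≤ ((n : ℝ) + 1) * (C * ((n : ℝ) + 1) ^ (-1 - (c - a - b).re)) := by
            gcongr
            · linarith
            · exact hb n
        _ = _ := by ring
    have : u 0 = 0 := by simp [u]
    simpa [this] using hu0.neg
  simp_rw [hu] at hd
  exact sub_eq_zero.1 (tendsto_nhds_unique hd.tendsto_sum_nat ht)

theorem tsum_gaussTerm_contiguous_iterate {a b c : ℂ} (h : 0 < (c - a - b).re) (N : ℕ) :
    poch (c - a - b) N * ∑' n, gaussTerm a b c n =
      poch (c - a) N * poch (c - b) N * ∑' n, gaussTerm a b (c + N) n := by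
  induction N with
  | zero => simp
  | succ N ih =>
    have h' : 0 < (c + N - a - b).re := by
      simp only [Complex.sub_re, Complex.add_re, Complex.natCast_re] at h ⊢
      linarith [N.cast_nonneg (α := ℝ)]
    have h1 := tsum_gaussTerm_contiguous h'
    have e : c + ((N + 1 : ℕ) : ℂ) = c + N + 1 := by push_cast; ring
    rw [poch_succ, poch_succ, poch_succ, e]
    calc _ = (c + N - a - b) * (poch (c - a - b) N * ∑' n, gaussTerm a b c n) := by ring
      _ = poch (c - a) N * poch (c - b) N *
          ((c + N - a - b) * ∑' n, gaussTerm a b (c + N) n) := by rw [ih]; ring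
      _ = _ := by rw [h1]; ring

theorem tendsto_Gamma_mul_tsum_gaussTerm {a b c : ℂ} (hc : 0 < c.re) (h : 0 < (c - a - b).re) :
    Tendsto (fun N : ℕ => Complex.Gamma (c + N) * ∑' n, gaussTerm a b (c + N) n) atTop (𝓝 1) := by
  have hcN : ∀ N : ℕ, 0 < (c + N).re := fun N => by
    simp only [Complex.add_re, Complex.natCast_re]; positivity
  have e : ∀ N : ℕ, Complex.Gamma (c + N) * ∑' n, gaussTerm a b (c + N) n =
      ∑' n : ℕ, poch a n / n.factorial * (poch b n / poch (c + N) n) := by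
    intro N
    rw [← tsum_mul_left]
    refine tsum_congr fun n => ?_
    rw [gaussTerm_eq_of_re_pos a b (hcN N)]
    field_simp [Complex.Gamma_ne_zero_of_re_pos (hcN N)]
  simp_rw [e]
  have h1 : (1 : ℂ) = ∑' n : ℕ, if n = 0 then 1 else 0 := by simp
  rw [h1]
  have hs : Summable fun n : ℕ => ‖poch a n / n.factorial * (poch b n / poch c n)‖ := by
    have := (summable_gaussTerm h).norm.mul_right ‖Complex.Gamma c‖
    refine this.congr fun n => ?_
    rw [gaussTerm_eq_of_re_pos a b hc, ← norm_mul]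
    congr 1
    field_simp [Complex.Gamma_ne_zero_of_re_pos hc]
  refine tendsto_tsum_of_dominated_convergence hs (fun n => ?_)
    (Eventually.of_forall fun N n => ?_)
  · rcases n with _ | n
    · simp
    · simp only [Nat.add_eq_zero_iff, one_ne_zero, and_false, if_false]
      have hT : Tendsto (fun N : ℕ => ‖poch a (n + 1) / (n + 1).factorial * poch b (n + 1) /
          poch (c + 1) n‖ * ((c.re + (N : ℝ)))⁻¹) atTop (𝓝 (‖poch a (n + 1) /
          (n + 1).factorial * poch b (n + 1) / poch (c + 1) n‖ * 0)) := by
        refine Tendsto.const_mul _ (tendsto_inv_atTop_zero.comp ?_)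
        exact tendsto_atTop_add_const_left _ _ tendsto_natCast_atTop_atTop
      rw [mul_zero] at hT
      refine squeeze_zero_norm (fun N => ?_) hT
      have hc1 : 0 < (c + 1).re := by simp only [Complex.add_re, Complex.one_re]; linarith
      have h2 : ‖poch (c + 1) n‖ ≤ ‖poch (c + 1 + N) n‖ := norm_poch_le_norm_poch_add hc1 N n
      have h3 : c.re + N ≤ ‖c + N‖ := by
        have := Complex.re_le_norm (c + N)
        simpa using this
      have h4 : 0 < ‖poch (c + 1) n‖ := norm_pos_iff.2 (poch_ne_zero_of_re_pos hc1 n)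
      have h5 : 0 < c.re + N := by positivity
      rw [poch_succ_left (c + N), add_right_comm c, ← mul_div_assoc, norm_div, norm_div,
        norm_mul (c + N : ℂ), ← div_eq_mul_inv, div_div]
      refine div_le_div_of_nonneg_left (norm_nonneg _) (by positivity) ?_
      rw [mul_comm ‖poch (c + 1) n‖]
      exact mul_le_mul h3 h2 h4.le (norm_nonneg _)
  · rw [norm_mul, norm_mul]
    gcongr
    rw [norm_div, norm_div]
    have h4 : 0 < ‖poch c n‖ := norm_pos_iff.2 (poch_ne_zero_of_re_pos hc n)
    gcongr
    exact norm_poch_le_norm_poch_add hc N n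

/-- Gauss's theorem when `c`, `c - a` and `c - b` lie in the right half plane: iterating the
contiguous relation moves `c` to infinity, where the quotient of the two sides tends to `1`. -/
theorem tsum_gaussTerm_of_re_pos {a b c : ℂ} (hc : 0 < c.re) (ha : 0 < (c - a).re)
    (hb : 0 < (c - b).re) (h : 0 < (c - a - b).re) :
    ∑' n, gaussTerm a b c n =
      Complex.Gamma (c - a - b) / (Complex.Gamma (c - a) * Complex.Gamma (c - b)) := by
  have hGc := Complex.Gamma_ne_zero_of_re_pos hc
  have hGa := Complex.Gamma_ne_zero_of_re_pos ha
  have hGb := Complex.Gamma_ne_zero_of_re_pos hb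
  have hGh := Complex.Gamma_ne_zero_of_re_pos h
  -- By the product formula for `Γ` and the iterated contiguous relation, the expression below is
  -- `Γ(c + N + 1)` times the sum with `c + N + 1` in place of `c`.
  have h1 : Tendsto (fun N : ℕ => (∑' n, gaussTerm a b c n) * Complex.Gamma c *
      (Complex.GammaSeq (c - a) N * Complex.GammaSeq (c - b) N /
        (Complex.GammaSeq (c - a - b) N * Complex.GammaSeq c N))) atTop
      (𝓝 ((∑' n, gaussTerm a b c n) * Complex.Gamma c *
      (Complex.Gamma (c - a) * Complex.Gamma (c - b) /
        (Complex.Gamma (c - a - b) * Complex.Gamma c)))) :=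
    (((Complex.GammaSeq_tendsto_Gamma _).mul (Complex.GammaSeq_tendsto_Gamma _)).div
      ((Complex.GammaSeq_tendsto_Gamma _).mul (Complex.GammaSeq_tendsto_Gamma _))
      (mul_ne_zero hGh hGc)).const_mul _
  have h2 := (tendsto_Gamma_mul_tsum_gaussTerm hc h).comp (tendsto_add_atTop_nat 1)
  have h3 := tendsto_nhds_unique (h1.congr' ?_) h2
  · field_simp at h3 ⊢
    linear_combination h3
  · filter_upwards [eventually_gt_atTop 0] with N hN
    have hN0 : (N : ℂ) ≠ 0 := by exact_mod_cast hN.ne'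
    have hf : (N.factorial : ℂ) ≠ 0 := by exact_mod_cast N.factorial_ne_zero
    have h4 := tsum_gaussTerm_contiguous_iterate h (N + 1)
    have p1 := poch_ne_zero_of_re_pos hc (N + 1)
    have p2 := poch_ne_zero_of_re_pos ha (N + 1)
    have p3 := poch_ne_zero_of_re_pos hb (N + 1)
    have p4 := poch_ne_zero_of_re_pos h (N + 1)
    have hpow : (N : ℂ) ^ (c - a) * (N : ℂ) ^ (c - b) = (N : ℂ) ^ (c - a - b) * (N : ℂ) ^ c := by
      rw [← Complex.cpow_add _ _ hN0, ← Complex.cpow_add _ _ hN0]; congr 1; ring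
    have q1 : (N : ℂ) ^ c ≠ 0 := by simp [Complex.cpow_eq_zero_iff, hN0]
    have q2 : (N : ℂ) ^ (c - a - b) ≠ 0 := by simp [Complex.cpow_eq_zero_iff, hN0]
    simp only [Function.comp]
    rw [Gamma_add_nat (ne_neg_nat_of_re_pos hc)]
    simp only [GammaSeq_eq_poch]
    set S := ∑' n, gaussTerm a b c n
    set S' := ∑' n, gaussTerm a b (c + ((N + 1 : ℕ) : ℂ)) n
    have h5 : S' = poch (c - a - b) (N + 1) * S /
        (poch (c - a) (N + 1) * poch (c - b) (N + 1)) := by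
      rw [h4]; field_simp
    have h6 : (N : ℂ) ^ (c - a) * N.factorial / poch (c - a) (N + 1) *
        ((N : ℂ) ^ (c - b) * N.factorial / poch (c - b) (N + 1)) =
        ((N : ℂ) ^ (c - a - b) * (N : ℂ) ^ c) * N.factorial ^ 2 /
          (poch (c - a) (N + 1) * poch (c - b) (N + 1)) := by
      rw [← hpow]; field_simp
    rw [h5, h6]
    field_simp

/-- **Gauss's theorem** on `₂F₁(a, b; c; 1)`, divided by `Γ(c)` so that it holds for all `c`. -/
theorem hasSum_gaussTerm {a b c : ℂ} (h : 0 < (c - a - b).re) :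
    HasSum (gaussTerm a b c)
      (Complex.Gamma (c - a - b) / (Complex.Gamma (c - a) * Complex.Gamma (c - b))) := by
  suffices ∑' n, gaussTerm a b c n =
      Complex.Gamma (c - a - b) / (Complex.Gamma (c - a) * Complex.Gamma (c - b)) from
    this ▸ (summable_gaussTerm h).hasSum
  -- The contiguous relation reduces `c` to `c + 1`, and so to the right half plane.
  obtain ⟨M, hM⟩ := exists_nat_gt (max (-c.re) (max (-(c - a).re) (-(c - b).re)))
  rw [max_lt_iff, max_lt_iff] at hM
  obtain ⟨h1, h2, h3⟩ := hM
  induction M generalizing c with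
  | zero =>
    simp only [Nat.cast_zero] at h1 h2 h3
    exact tsum_gaussTerm_of_re_pos (by linarith) (by linarith) (by linarith) h
  | succ M ih =>
    have h' : 0 < (c + 1 - a - b).re := by
      simp only [Complex.sub_re, Complex.add_re, Complex.one_re] at h ⊢; linarith
    push_cast at h1 h2 h3
    have ih' := ih (c := c + 1) h'
      (by simp only [Complex.add_re, Complex.one_re] at h1 ⊢; linarith)
      (by simp only [Complex.sub_re, Complex.add_re, Complex.one_re] at h2 ⊢; linarith)
      (by simp only [Complex.sub_re, Complex.add_re, Complex.one_re] at h3 ⊢; linarith)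
    have h0 : c - a - b ≠ 0 := fun h0 => by simp [h0] at h
    have hrec := tsum_gaussTerm_contiguous h
    rw [ih'] at hrec
    refine mul_left_cancel₀ h0 (hrec.trans ?_)
    have g1 := Complex.one_div_Gamma_eq_self_mul_one_div_Gamma_add_one (c - a)
    have g2 := Complex.one_div_Gamma_eq_self_mul_one_div_Gamma_add_one (c - b)
    have g3 := Complex.Gamma_add_one _ h0
    have e1 : c + 1 - a - b = c - a - b + 1 := by ring
    have e2 : c + 1 - a = c - a + 1 := by ring
    have e3 : c + 1 - b = c - b + 1 := by ring
    rw [e1, e2, e3, g3, div_eq_mul_inv, mul_inv, div_eq_mul_inv _ (_ * _), mul_inv, g1, g2]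
    ring

/-! ### The transformed Appell series and its beta integral -/

theorem summable_rpow_mul_geometric (s : ℝ) {r : ℝ} (hr0 : 0 ≤ r) (hr1 : r < 1) :
    Summable fun k : ℕ => ((k : ℝ) + 1) ^ s * r ^ k := by
  obtain ⟨K, hK⟩ := exists_nat_ge s
  have hq0 : 0 < (r + 1) / 2 := by linarith
  have h1 := (summable_nat_add_iff 1).2 (summable_pow_mul_geometric_of_norm_lt_one K
    (r := (r + 1) / 2) (by rw [Real.norm_of_nonneg hq0.le]; linarith))
  refine Summable.of_nonneg_of_le (fun k => by positivity) (fun k => ?_)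
    (h1.mul_right ((r + 1) / 2)⁻¹)
  have h2 : ((k : ℝ) + 1) ^ s ≤ ((k : ℝ) + 1) ^ K := by
    rw [← Real.rpow_natCast]
    exact Real.rpow_le_rpow_of_exponent_le (by linarith [k.cast_nonneg (α := ℝ)]) hK
  have h3 : r ^ k ≤ ((r + 1) / 2) ^ k := pow_le_pow_left₀ hr0 (by linarith) k
  calc _ ≤ ((k : ℝ) + 1) ^ K * ((r + 1) / 2) ^ k := by gcongr
    _ = _ := by rw [pow_succ]; push_cast; field_simp

/-- The coefficients of the double power series obtained from Appell's `F₃(a, a', b, b'; γ; X, Y)`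
by Pfaff's transformation `Y ↦ Y / (Y - 1)` in the second variable. The symbol `(γ)_{m+n}` is split
into `(γ)_m (γ + m)_n`. -/
def pfaffCoeff (a a' b b' γ : ℂ) (p : ℕ × ℕ) : ℂ :=
  poch a p.1 * poch b p.1 / (poch γ p.1 * p.1.factorial) * (poch a' p.2 / p.2.factorial) *
    (poch (γ + -b' + p.1) p.2 / poch (γ + p.1) p.2)

theorem exists_norm_pfaffCoeff_le (a a' b b' γ : ℂ) (hγ : 0 < γ.re) : ∃ C : ℝ, 0 < C ∧
    ∀ p : ℕ × ℕ, ‖pfaffCoeff a a' b b' γ p‖ ≤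
      C * (((p.1 : ℝ) + 1) ^ (a.re + b.re - 1 - γ.re + b'.re) * ((p.2 : ℝ) + 1) ^ (a'.re - 1) *
        (((p.1 + p.2 : ℕ) : ℝ) + 1) ^ (-b'.re)) := by
  obtain ⟨C₁, hC₁, h₁⟩ := exists_norm_poch_div_factorial_le a
  obtain ⟨C₂, hC₂, h₂⟩ := exists_norm_poch_div_le' γ b hγ
  obtain ⟨C₃, hC₃, h₃⟩ := exists_norm_poch_div_factorial_le a'
  obtain ⟨C₄, hC₄, h₄⟩ := exists_norm_poch_div_le γ (-b') hγ
  refine ⟨C₁ * C₂ * C₃ * C₄, by positivity, fun p => ?_⟩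
  have e : pfaffCoeff a a' b b' γ p = (poch a p.1 / p.1.factorial) * (poch b p.1 / poch γ p.1) *
      (poch a' p.2 / p.2.factorial) * (poch (γ + -b' + p.1) p.2 / poch (γ + p.1) p.2) := by
    rw [pfaffCoeff]; ring
  have h4 := h₄ p.1 p.2
  rw [Real.div_rpow (by positivity) (by positivity), Complex.neg_re,
    Real.rpow_neg (x := (p.1 : ℝ) + 1) (by positivity), div_inv_eq_mul] at h4
  have e2 : ((p.1 : ℝ) + 1) ^ (a.re + b.re - 1 - γ.re + b'.re) = ((p.1 : ℝ) + 1) ^ (a.re - 1) *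
      ((p.1 : ℝ) + 1) ^ (b.re - γ.re) * ((p.1 : ℝ) + 1) ^ b'.re := by
    rw [← Real.rpow_add (by positivity), ← Real.rpow_add (by positivity)]; congr 1; ring
  rw [e, norm_mul, norm_mul, norm_mul, e2]
  calc _ ≤ (C₁ * ((p.1 : ℝ) + 1) ^ (a.re - 1)) * (C₂ * ((p.1 : ℝ) + 1) ^ (b.re - γ.re)) *
        (C₃ * ((p.2 : ℝ) + 1) ^ (a'.re - 1)) *
        (C₄ * ((((p.1 + p.2 : ℕ) : ℝ) + 1) ^ (-b'.re) * ((p.1 : ℝ) + 1) ^ b'.re)) := by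
        gcongr
        · exact h₁ _
        · exact h₂ _
        · exact h₃ _
    _ = _ := by ring

theorem summable_norm_pfaffCoeff_mul_pow (a a' b b' γ : ℂ) (hγ : 0 < γ.re) {r : ℝ} (hr0 : 0 ≤ r)
    (hr1 : r < 1) : Summable fun p : ℕ × ℕ => ‖pfaffCoeff a a' b b' γ p‖ * r ^ (p.1 + p.2) := by
  obtain ⟨C, hC, h⟩ := exists_norm_pfaffCoeff_le a a' b b' γ hγ
  have hs := ((summable_rpow_mul_geometric (a.re + b.re - 1 - γ.re + b'.re + |b'.re|) hr0
    hr1).mul_of_nonneg (summable_rpow_mul_geometric (a'.re - 1 + |b'.re|) hr0 hr1)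
    (fun k => by positivity) (fun k => by positivity)).mul_left C
  refine Summable.of_nonneg_of_le (fun p => by positivity) (fun p => ?_) hs
  have h1 : (1 : ℝ) ≤ ((p.1 + p.2 : ℕ) : ℝ) + 1 := by
    linarith [(p.1 + p.2).cast_nonneg (α := ℝ)]
  have h2 : (((p.1 + p.2 : ℕ) : ℝ) + 1) ^ (-b'.re) ≤
      ((p.1 : ℝ) + 1) ^ |b'.re| * ((p.2 : ℝ) + 1) ^ |b'.re| := by
    rw [← Real.mul_rpow (by positivity) (by positivity)]
    refine (Real.rpow_le_rpow_of_exponent_le h1 (neg_le_abs _)).trans ?_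
    refine Real.rpow_le_rpow (by positivity) ?_ (abs_nonneg _)
    push_cast
    nlinarith [mul_nonneg (p.1.cast_nonneg (α := ℝ)) (p.2.cast_nonneg (α := ℝ))]
  calc _ ≤ C * (((p.1 : ℝ) + 1) ^ (a.re + b.re - 1 - γ.re + b'.re) * ((p.2 : ℝ) + 1) ^ (a'.re - 1) *
        (((p.1 : ℝ) + 1) ^ |b'.re| * ((p.2 : ℝ) + 1) ^ |b'.re|)) * r ^ (p.1 + p.2) := by
        gcongr
        refine (h p).trans ?_
        gcongr
    _ = _ := by
        rw [Real.rpow_add (x := (p.1 : ℝ) + 1) (by positivity) _ |b'.re|,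
          Real.rpow_add (x := (p.2 : ℝ) + 1) (by positivity) _ |b'.re|, pow_add]
        ring

/-- The restriction `w ↦ ∑ c_{m,n} w ^ (m + n)` of the transformed Appell series to the diagonal. -/
def pfaffDiag (a a' b b' γ w : ℂ) : ℂ :=
  ∑' p : ℕ × ℕ, pfaffCoeff a a' b b' γ p * w ^ (p.1 + p.2)

theorem summable_pfaffDiag (a a' b b' γ : ℂ) (hγ : 0 < γ.re) {w : ℂ} (hw : ‖w‖ < 1) :
    Summable fun p : ℕ × ℕ => pfaffCoeff a a' b b' γ p * w ^ (p.1 + p.2) := by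
  refine Summable.of_norm ?_
  simp_rw [norm_mul, norm_pow]
  exact summable_norm_pfaffCoeff_mul_pow a a' b b' γ hγ (norm_nonneg w) hw

/-- Integration term by term, including the integrability of the sum. -/
theorem integrable_and_hasSum_integral {Ω ι : Type*} [MeasurableSpace Ω] {μ : Measure Ω}
    [Countable ι] {F : ι → Ω → ℂ} {f : Ω → ℂ} (hF : ∀ i, Integrable (F i) μ)
    (hs : Summable fun i => ∫ x, ‖F i x‖ ∂μ) (hf : ∀ᵐ x ∂μ, HasSum (fun i => F i x) (f x)) :
    Integrable f μ ∧ HasSum (fun i => ∫ x, F i x ∂μ) (∫ x, f x ∂μ) := by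
  have hfe : f =ᵐ[μ] fun x => ∑' i, F i x := hf.mono fun x hx => hx.tsum_eq.symm
  refine ⟨⟨?_, ?_⟩, ?_⟩
  · refine aestronglyMeasurable_of_tendsto_ae (ι := Finset ι) atTop
      (f := fun s x => ∑ i ∈ s, F i x) (fun s => ?_) hf
    exact (integrable_finsetSum s fun i _ => hF i).aestronglyMeasurable
  · rw [hasFiniteIntegral_congr hfe]
    calc ∫⁻ x, ‖∑' i, F i x‖ₑ ∂μ ≤ ∫⁻ x, ∑' i, ‖F i x‖ₑ ∂μ :=
          lintegral_mono fun x => enorm_tsum_le_tsum_enorm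
      _ = ∑' i, ∫⁻ x, ‖F i x‖ₑ ∂μ := lintegral_tsum fun i => (hF i).aestronglyMeasurable.enorm
      _ = ∑' i, ENNReal.ofReal (∫ x, ‖F i x‖ ∂μ) := by
          refine tsum_congr fun i => ?_
          rw [ofReal_integral_norm_eq_lintegral_enorm (hF i)]
      _ < ⊤ := by
          rw [← ENNReal.ofReal_tsum_of_nonneg (fun i => by positivity) hs]
          exact ENNReal.ofReal_lt_top
  · rw [integral_congr_ae hfe]
    exact hasSum_integral_of_summable_integral_norm hF hs

/-- The integrand of the Euler beta integral. -/
def betaKernel (u v : ℂ) (x : ℝ) : ℂ := (x : ℂ) ^ (u - 1) * (1 - (x : ℂ)) ^ (v - 1)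

theorem integrableOn_betaKernel {u v : ℂ} (hu : 0 < u.re) (hv : 0 < v.re) :
    IntegrableOn (betaKernel u v) (Set.Ioo 0 1) := by
  have := Complex.betaIntegral_convergent hu hv
  rw [intervalIntegrable_iff_integrableOn_Ioo_of_le zero_le_one] at this
  exact this

theorem integral_betaKernel {u v : ℂ} (hu : 0 < u.re) (hv : 0 < v.re) :
    ∫ x in Set.Ioo 0 1, betaKernel u v x =
      Complex.Gamma u * Complex.Gamma v / Complex.Gamma (u + v) := by
  rw [← Complex.betaIntegral_eq_Gamma_mul_div u v hu hv, Complex.betaIntegral,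
    intervalIntegral.integral_of_le zero_le_one, integral_Ioc_eq_integral_Ioo]
  rfl

theorem norm_betaKernel (u v : ℂ) {x : ℝ} (hx : x ∈ Set.Ioo (0 : ℝ) 1) :
    ((‖betaKernel u v x‖ : ℝ) : ℂ) = betaKernel u.re v.re x := by
  have h1 : 0 < 1 - x := by linarith [hx.2]
  have e : (1 - (x : ℂ)) = ((1 - x : ℝ) : ℂ) := by push_cast; ring
  rw [betaKernel, betaKernel, norm_mul, e, Complex.norm_cpow_eq_rpow_re_of_pos hx.1,
    Complex.norm_cpow_eq_rpow_re_of_pos h1, Complex.ofReal_mul, Complex.ofReal_cpow hx.1.le,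
    Complex.ofReal_cpow h1.le]
  simp

theorem integral_norm_betaKernel {u v : ℂ} (hu : 0 < u.re) (hv : 0 < v.re) :
    ∫ x in Set.Ioo 0 1, ‖betaKernel u v x‖ = ‖Complex.Gamma u.re * Complex.Gamma v.re /
      Complex.Gamma (u.re + v.re)‖ := by
  rw [← integral_betaKernel (by simpa using hu) (by simpa using hv)]
  have : ∫ x in Set.Ioo 0 1, betaKernel u.re v.re x =
      ((∫ x in Set.Ioo 0 1, ‖betaKernel u v x‖ : ℝ) : ℂ) := by
    rw [← integral_complex_ofReal]
    exact setIntegral_congr_fun measurableSet_Ioo fun x hx => (norm_betaKernel u v hx).symm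
  rw [this, Complex.norm_real, Real.norm_of_nonneg (integral_nonneg fun x => norm_nonneg _)]

theorem exists_integral_norm_betaKernel_le {u v : ℂ} (hu : 0 < u.re) (hv : 0 < v.re) :
    ∃ C : ℝ, 0 < C ∧ ∀ N : ℕ, ∫ x in Set.Ioo 0 1, ‖betaKernel (u + N) v x‖ ≤
      C * ((N : ℝ) + 1) ^ (-v.re) := by
  have huv : 0 < ((u.re : ℂ) + v.re).re := by simp; linarith
  obtain ⟨C, hC, h⟩ := exists_norm_poch_div_le' (u.re + v.re) u.re huv
  have hGu : 0 < (u.re : ℂ).re := by simpa using hu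
  have hg1 := Complex.Gamma_ne_zero_of_re_pos hGu
  have hg2 := Complex.Gamma_ne_zero_of_re_pos (s := (v.re : ℂ)) (by simpa using hv)
  have hg3 := Complex.Gamma_ne_zero_of_re_pos huv
  refine ⟨‖Complex.Gamma u.re * Complex.Gamma v.re / Complex.Gamma (u.re + v.re)‖ * C,
    mul_pos (norm_pos_iff.2 (div_ne_zero (mul_ne_zero hg1 hg2) hg3)) hC,
    fun N => ?_⟩
  have huN : 0 < (u + N).re := by simp; positivity
  rw [integral_norm_betaKernel huN hv]
  have e1 : (((u + N).re : ℝ) : ℂ) = u.re + N := by simp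
  rw [e1, add_right_comm, Gamma_add_nat (ne_neg_nat_of_re_pos hGu),
    Gamma_add_nat (ne_neg_nat_of_re_pos huv)]
  have e2 : Complex.Gamma u.re * poch u.re N * Complex.Gamma v.re /
      (Complex.Gamma (u.re + v.re) * poch (u.re + v.re) N) =
      Complex.Gamma u.re * Complex.Gamma v.re / Complex.Gamma (u.re + v.re) *
        (poch u.re N / poch (u.re + v.re) N) := by
    ring
  rw [e2, norm_mul, mul_assoc]
  refine mul_le_mul_of_nonneg_left ((h N).trans (le_of_eq ?_)) (norm_nonneg _)
  congr 2
  simp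

theorem betaKernel_mul_pow (u v : ℂ) (N : ℕ) {x : ℝ} (hx : x ∈ Set.Ioo (0 : ℝ) 1) :
    betaKernel (u + N) v x = betaKernel u v x * (x : ℂ) ^ N := by
  have hx0 : (x : ℂ) ≠ 0 := by exact_mod_cast hx.1.ne'
  rw [betaKernel, betaKernel, add_sub_right_comm, Complex.cpow_add _ _ hx0, Complex.cpow_natCast]
  ring

theorem summable_double_rpow {e d s : ℝ} (he : 0 < e) (hd : 0 < d) (hs : 0 < s) :
    Summable fun p : ℕ × ℕ => ((p.1 : ℝ) + 1) ^ (-1 - e + d) * ((p.2 : ℝ) + 1) ^ (s - 1) *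
      (((p.1 + p.2 : ℕ) : ℝ) + 1) ^ (-d - s) := by
  -- Part of the decay in `m + n` makes the sum over `n` converge, and the rest is left to `m`.
  set ε := min e d / 2 with hε
  have hm : 0 < min e d := lt_min he hd
  have hme : min e d ≤ e := min_le_left _ _
  have hmd : min e d ≤ d := min_le_right _ _
  have h := (summable_nat_add_one_rpow (s := -1 - e + ε) (by linarith)).mul_of_nonneg
    (summable_nat_add_one_rpow (s := -1 - ε) (by linarith)) (fun k => by positivity)
    (fun k => by positivity)
  refine Summable.of_nonneg_of_le (fun p => by positivity) (fun p => ?_) h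
  have h1 : (((p.1 + p.2 : ℕ) : ℝ) + 1) ^ (-d - s) ≤
      ((p.1 : ℝ) + 1) ^ (-d + ε) * ((p.2 : ℝ) + 1) ^ (-s - ε) := by
    have e1 : -d - s = (-d + ε) + (-s - ε) := by ring
    rw [e1, Real.rpow_add (by positivity)]
    push_cast
    gcongr ?_ * ?_
    · refine Real.rpow_le_rpow_of_nonpos (by positivity) ?_ (by linarith)
      linarith [p.2.cast_nonneg (α := ℝ)]
    · refine Real.rpow_le_rpow_of_nonpos (by positivity) ?_ (by linarith)
      linarith [p.1.cast_nonneg (α := ℝ)]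
  calc _ ≤ ((p.1 : ℝ) + 1) ^ (-1 - e + d) * ((p.2 : ℝ) + 1) ^ (s - 1) *
        (((p.1 : ℝ) + 1) ^ (-d + ε) * ((p.2 : ℝ) + 1) ^ (-s - ε)) := by gcongr
    _ = (((p.1 : ℝ) + 1) ^ (-1 - e + d) * ((p.1 : ℝ) + 1) ^ (-d + ε)) *
        (((p.2 : ℝ) + 1) ^ (s - 1) * ((p.2 : ℝ) + 1) ^ (-s - ε)) := by ring
    _ = _ := by
        rw [← Real.rpow_add (by positivity), ← Real.rpow_add (by positivity)]
        congr 2 <;> ring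

/-- The value of `∫₀¹ w ^ (γ - 1) (1 - w) ^ (δ - 1) H(w) dw`, where `H` is `pfaffDiag`. -/
def pfaffDiagIntegral (a a' b b' γ δ : ℂ) : ℂ :=
  Complex.Gamma γ * (Complex.Gamma δ * Complex.Gamma (δ + b' - a') *
    Complex.Gamma (γ + δ - a' - a - b) / (Complex.Gamma (δ + b') *
      Complex.Gamma (γ + δ - a' - a) * Complex.Gamma (γ + δ - a' - b)))

/-- Absolute convergence for `0 < Re a'`; it can fail when `Re a'` and `Re b'` are negative. -/
theorem summable_integral_norm_pfaffDiag {a a' b b' γ δ : ℂ} (hγ : 0 < γ.re) (hδ : 0 < δ.re)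
    (hδ' : 0 < (δ + b' - a').re) (he : 0 < (γ + δ - a' - a - b).re) (ha' : 0 < a'.re) :
    Summable fun p : ℕ × ℕ => ∫ x in Set.Ioo 0 1,
      ‖pfaffCoeff a a' b b' γ p * betaKernel (γ + (p.1 + p.2 : ℕ)) δ x‖ := by
  obtain ⟨C, hC, h⟩ := exists_norm_pfaffCoeff_le a a' b b' γ hγ
  obtain ⟨C', hC', h'⟩ := exists_integral_norm_betaKernel_le hγ hδ
  refine Summable.of_nonneg_of_le (fun p => by positivity) (fun p => ?_)
    ((summable_double_rpow he hδ' ha').mul_left (C * C'))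
  simp_rw [norm_mul]
  rw [integral_const_mul]
  have e1 : a.re + b.re - 1 - γ.re + b'.re =
      -1 - (γ + δ - a' - a - b).re + (δ + b' - a').re := by simp; ring
  have e2 : -(δ + b' - a').re - a'.re = -b'.re + -δ.re := by simp
  rw [← e1, e2, Real.rpow_add (x := ((p.1 + p.2 : ℕ) : ℝ) + 1) (by positivity)]
  calc _ ≤ (C * (((p.1 : ℝ) + 1) ^ (a.re + b.re - 1 - γ.re + b'.re) *
        ((p.2 : ℝ) + 1) ^ (a'.re - 1) * (((p.1 + p.2 : ℕ) : ℝ) + 1) ^ (-b'.re))) *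
        (C' * (((p.1 + p.2 : ℕ) : ℝ) + 1) ^ (-δ.re)) := by
        gcongr
        · exact h p
        · exact h' _
    _ = _ := by ring

/-- The sum of the beta integrals of the terms. Summing first over `n` and then over `m`, Gauss's
theorem applies twice. -/
theorem hasSum_pfaffCoeff_mul_beta {a a' b b' γ δ I : ℂ} (hγ : 0 < γ.re)
    (hδ' : 0 < (δ + b' - a').re) (he : 0 < (γ + δ - a' - a - b).re)
    (hI : HasSum (fun p : ℕ × ℕ => pfaffCoeff a a' b b' γ p *
      (Complex.Gamma (γ + (p.1 + p.2 : ℕ)) * Complex.Gamma δ /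
        Complex.Gamma (γ + (p.1 + p.2 : ℕ) + δ))) I) :
    I = pfaffDiagIntegral a a' b b' γ δ := by
  have inner : ∀ m : ℕ, HasSum (fun n : ℕ => pfaffCoeff a a' b b' γ (m, n) *
      (Complex.Gamma (γ + (m + n : ℕ)) * Complex.Gamma δ / Complex.Gamma (γ + (m + n : ℕ) + δ)))
      (Complex.Gamma γ * Complex.Gamma δ * Complex.Gamma (δ + b' - a') / Complex.Gamma (δ + b') *
        gaussTerm a b (γ + δ - a') m) := by
    intro m
    have hg := hasSum_gaussTerm (a := a') (b := γ + -b' + m) (c := γ + δ + m) (by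
      have : γ + δ + m - a' - (γ + -b' + m) = δ + b' - a' := by ring
      rwa [this])
    have hg := hg.mul_left
      (Complex.Gamma γ * Complex.Gamma δ * (poch a m * poch b m / m.factorial))
    have hfun : ∀ n : ℕ, pfaffCoeff a a' b b' γ (m, n) * (Complex.Gamma (γ + (m + n : ℕ)) *
        Complex.Gamma δ / Complex.Gamma (γ + (m + n : ℕ) + δ)) = Complex.Gamma γ * Complex.Gamma δ *
        (poch a m * poch b m / m.factorial) * gaussTerm a' (γ + -b' + m) (γ + δ + m) n := by
      intro n
      rw [Gamma_add_nat (ne_neg_nat_of_re_pos hγ), poch_add, pfaffCoeff, gaussTerm]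
      have e1 : γ + ((m + n : ℕ) : ℂ) + δ = γ + δ + m + n := by push_cast; ring
      have h1 := poch_ne_zero_of_re_pos hγ m
      have h2 : poch (γ + m) n ≠ 0 := poch_ne_zero_of_re_pos (by simp; positivity) n
      rw [e1]
      simp only
      field_simp
    have e1 : γ + δ + m - a' - (γ + -b' + m) = δ + b' - a' := by ring
    have e2 : γ + δ + m - a' = γ + δ - a' + m := by ring
    have e3 : γ + δ + m - (γ + -b' + m) = δ + b' := by ring
    rw [e1, e2, e3] at hg
    simp_rw [hfun]
    have hval : Complex.Gamma γ * Complex.Gamma δ * Complex.Gamma (δ + b' - a') /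
        Complex.Gamma (δ + b') * gaussTerm a b (γ + δ - a') m =
        Complex.Gamma γ * Complex.Gamma δ * (poch a m * poch b m / m.factorial) *
          (Complex.Gamma (δ + b' - a') /
            (Complex.Gamma (γ + δ - a' + m) * Complex.Gamma (δ + b'))) := by
      rw [gaussTerm]
      ring
    rw [hval]
    exact hg
  have h1 := hI.prod_fiberwise inner
  have h2 := (hasSum_gaussTerm (a := a) (b := b) (c := γ + δ - a') he).mul_left
    (Complex.Gamma γ * Complex.Gamma δ * Complex.Gamma (δ + b' - a') / Complex.Gamma (δ + b'))
  rw [h1.unique h2, pfaffDiagIntegral]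
  ring

theorem integral_pfaffDiag_of_re_pos {a a' b b' γ δ : ℂ} (hγ : 0 < γ.re) (hδ : 0 < δ.re)
    (hδ' : 0 < (δ + b' - a').re) (he : 0 < (γ + δ - a' - a - b).re) (ha' : 0 < a'.re) :
    IntegrableOn (fun x : ℝ => betaKernel γ δ x * pfaffDiag a a' b b' γ x) (Set.Ioo 0 1) ∧
      ∫ x in Set.Ioo 0 1, betaKernel γ δ x * pfaffDiag a a' b b' γ x =
        pfaffDiagIntegral a a' b b' γ δ := by
  have hN : ∀ N : ℕ, 0 < (γ + N).re := fun N => by simp; positivity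
  have key := integrable_and_hasSum_integral (μ := volume.restrict (Set.Ioo (0 : ℝ) 1))
    (F := fun (p : ℕ × ℕ) (x : ℝ) =>
      pfaffCoeff a a' b b' γ p * betaKernel (γ + (p.1 + p.2 : ℕ)) δ x)
    (f := fun x : ℝ => betaKernel γ δ x * pfaffDiag a a' b b' γ x)
    (fun p => (integrableOn_betaKernel (hN _) hδ).const_mul _)
    (summable_integral_norm_pfaffDiag hγ hδ hδ' he ha') (by
      refine (ae_restrict_iff' measurableSet_Ioo).2 (Eventually.of_forall fun x hx => ?_)
      have hx1 : ‖(x : ℂ)‖ < 1 := by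
        rw [Complex.norm_real, Real.norm_of_nonneg hx.1.le]; exact hx.2
      have := (summable_pfaffDiag a a' b b' γ hγ hx1).hasSum.mul_left (betaKernel γ δ x)
      refine this.congr_fun fun p => ?_
      rw [betaKernel_mul_pow _ _ _ hx]
      ring)
  refine ⟨key.1, hasSum_pfaffCoeff_mul_beta hγ hδ' he ?_⟩
  refine key.2.congr_fun fun p => ?_
  rw [integral_const_mul, integral_betaKernel (hN _) hδ]

/-! ### Contiguous functions -/

theorem pfaffCoeff_contiguous_zero (a a' b b' γ : ℂ) (m : ℕ) :
    pfaffCoeff a a' b b' γ (m, 0) = pfaffCoeff a (a' + 1) b b' γ (m, 0) := by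
  simp [pfaffCoeff]

theorem pfaffCoeff_contiguous_succ (a a' b b' : ℂ) {γ : ℂ} (hγ : 0 < γ.re) (m n : ℕ) :
    pfaffCoeff a a' b b' γ (m, n + 1) = pfaffCoeff a (a' + 1) b b' γ (m, n + 1) -
      pfaffCoeff a (a' + 1) b b' γ (m, n) +
      b' / γ * pfaffCoeff a (a' + 1) b (b' + 1) (γ + 1) (m, n) := by
  have hγ0 : γ ≠ 0 := fun h => by simp [h] at hγ
  have hγm : 0 < (γ + m).re := by simp; positivity
  have hγmn : 0 < (γ + m + n).re := by simp; positivity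
  have h1 : γ + m ≠ 0 := fun h => by rw [h] at hγm; simp at hγm
  have h2 : γ + m + n ≠ 0 := fun h => by rw [h] at hγmn; simp at hγmn
  have h3 := poch_ne_zero_of_re_pos hγ m
  have h4 : poch (γ + 1 + m) n ≠ 0 := poch_ne_zero_of_re_pos (by simp; positivity) n
  have h5 : (n.factorial : ℂ) ≠ 0 := by exact_mod_cast n.factorial_ne_zero
  have h6 : ((n : ℂ) + 1) ≠ 0 := by exact_mod_cast n.succ_ne_zero
  have h7 : (m.factorial : ℂ) ≠ 0 := by exact_mod_cast m.factorial_ne_zero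
  have e1 : poch (γ + 1) m = poch γ m * (γ + m) / γ := by
    rw [eq_div_iff hγ0, ← poch_succ, poch_succ_left]; ring
  have e2 : poch (γ + m) (n + 1) = (γ + m) * poch (γ + 1 + m) n := by
    rw [poch_succ_left, add_right_comm]
  have e3 : poch (γ + m) n = (γ + m) * poch (γ + 1 + m) n / (γ + m + n) := by
    rw [eq_div_iff h2, ← e2, poch_succ]
  have e4 : γ + 1 + -(b' + 1) + m = γ + -b' + m := by ring
  simp only [pfaffCoeff]
  rw [e1, e2, e3, e4, poch_succ (γ + -b' + m), poch_succ (a' + 1), poch_succ_left a',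
    Nat.factorial_succ]
  push_cast
  field_simp
  ring

theorem tsum_prod_eq_zero_add {f : ℕ × ℕ → ℂ} (hf : Summable f) :
    ∑' p, f p = ∑' m, f (m, 0) + ∑' p : ℕ × ℕ, f (p.1, p.2 + 1) := by
  have h1 : Summable fun m : ℕ => f (m, 0) :=
    hf.comp_injective (Prod.mk_left_injective 0)
  have h2 : Summable fun p : ℕ × ℕ => f (p.1, p.2 + 1) :=
    hf.comp_injective (i := fun p : ℕ × ℕ => (p.1, p.2 + 1)) fun p q h => by
      simpa [Prod.ext_iff] using h
  rw [hf.tsum_prod, h2.tsum_prod, ← h1.tsum_add h2.prod]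
  exact tsum_congr fun m => (hf.prod_factor m).tsum_eq_zero_add

/-- The relation between contiguous functions which increases `a'`. After multiplication by
`w ^ (γ - 1) (1 - w) ^ (δ - 1)` both terms on the right are again beta-weighted, with `(γ, δ + 1)`
and `(γ + 1, δ)` in place of `(γ, δ)`. -/
theorem pfaffDiag_contiguous (a a' b b' : ℂ) {γ : ℂ} (hγ : 0 < γ.re) {w : ℂ} (hw : ‖w‖ < 1) :
    pfaffDiag a a' b b' γ w = (1 - w) * pfaffDiag a (a' + 1) b b' γ w +
      b' / γ * (w * pfaffDiag a (a' + 1) b (b' + 1) (γ + 1) w) := by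
  have hγ1 : 0 < (γ + 1).re := by simp; linarith
  have s0 := summable_pfaffDiag a a' b b' γ hγ hw
  have s1 := summable_pfaffDiag a (a' + 1) b b' γ hγ hw
  have s2 := summable_pfaffDiag a (a' + 1) b (b' + 1) (γ + 1) hγ1 hw
  have s1' : Summable fun p : ℕ × ℕ =>
      pfaffCoeff a (a' + 1) b b' γ (p.1, p.2 + 1) * w ^ (p.1 + (p.2 + 1)) :=
    s1.comp_injective (i := fun p : ℕ × ℕ => (p.1, p.2 + 1)) fun p q h => by
      simpa [Prod.ext_iff] using h
  have e0 := tsum_prod_eq_zero_add s0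
  have e1 := tsum_prod_eq_zero_add s1
  have e2 : ∑' p : ℕ × ℕ, pfaffCoeff a a' b b' γ (p.1, p.2 + 1) * w ^ (p.1 + (p.2 + 1)) =
      (∑' p : ℕ × ℕ, pfaffCoeff a (a' + 1) b b' γ (p.1, p.2 + 1) * w ^ (p.1 + (p.2 + 1))) -
        w * pfaffDiag a (a' + 1) b b' γ w +
        b' / γ * (w * pfaffDiag a (a' + 1) b (b' + 1) (γ + 1) w) := by
    rw [pfaffDiag, pfaffDiag, ← tsum_mul_left, ← tsum_mul_left, ← tsum_mul_left,
      ← s1'.tsum_sub (s1.mul_left w),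
      ← (s1'.sub (s1.mul_left w)).tsum_add ((s2.mul_left w).mul_left (b' / γ))]
    refine tsum_congr fun p => ?_
    rw [pfaffCoeff_contiguous_succ a a' b b' hγ]
    ring
  simp only at e0 e1
  rw [e2] at e0
  simp_rw [pfaffCoeff_contiguous_zero a a'] at e0
  have f0 : pfaffDiag a a' b b' γ w =
    ∑' p : ℕ × ℕ, pfaffCoeff a a' b b' γ p * w ^ (p.1 + p.2) := rfl
  have f1 : pfaffDiag a (a' + 1) b b' γ w =
    ∑' p : ℕ × ℕ, pfaffCoeff a (a' + 1) b b' γ p * w ^ (p.1 + p.2) := rfl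
  rw [← f0] at e0
  rw [← f1] at e1
  linear_combination e0 - e1

theorem betaKernel_add_one_right (u v : ℂ) {x : ℝ} (hx : x ∈ Set.Ioo (0 : ℝ) 1) :
    betaKernel u (v + 1) x = betaKernel u v x * (1 - x) := by
  have hx0 : 1 - (x : ℂ) ≠ 0 := by
    have : 1 - x ≠ 0 := by linarith [hx.2]
    exact_mod_cast this
  rw [betaKernel, betaKernel, add_sub_right_comm, Complex.cpow_add _ _ hx0, Complex.cpow_one]
  ring

theorem pfaffDiagIntegral_contiguous (a a' b b' : ℂ) {γ δ : ℂ} (hγ : 0 < γ.re) (hδ : 0 < δ.re) :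
    pfaffDiagIntegral a a' b b' γ δ = pfaffDiagIntegral a (a' + 1) b b' γ (δ + 1) +
      b' / γ * pfaffDiagIntegral a (a' + 1) b (b' + 1) (γ + 1) δ := by
  have hγ0 : γ ≠ 0 := fun h => by simp [h] at hγ
  have hδ0 : δ ≠ 0 := fun h => by simp [h] at hδ
  have g := Complex.one_div_Gamma_eq_self_mul_one_div_Gamma_add_one (δ + b')
  have e1 : δ + 1 + b' = δ + b' + 1 := by ring
  have e2 : δ + b' + 1 - (a' + 1) = δ + b' - a' := by ring
  have e3 : γ + (δ + 1) - (a' + 1) = γ + δ - a' := by ring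
  have e4 : δ + (b' + 1) = δ + b' + 1 := by ring
  have e5 : γ + 1 + δ - (a' + 1) = γ + δ - a' := by ring
  simp only [pfaffDiagIntegral]
  rw [e1, e2, e3, e4, e2, e5, Complex.Gamma_add_one γ hγ0, Complex.Gamma_add_one δ hδ0]
  simp only [div_eq_mul_inv, mul_inv]
  rw [g]
  field_simp

/-- The value of the beta-weighted integral, also where the double series of the integrals of the
terms does not converge absolutely (which happens when `a'` and `b'` both have negative real part):
the contiguous relation, applied repeatedly, reduces to the case `0 < Re a'`. -/
theorem integral_pfaffDiag {a a' b b' γ δ : ℂ} (hγ : 0 < γ.re) (hδ : 0 < δ.re)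
    (hδ' : 0 < (δ + b' - a').re) (he : 0 < (γ + δ - a' - a - b).re) :
    IntegrableOn (fun x : ℝ => betaKernel γ δ x * pfaffDiag a a' b b' γ x) (Set.Ioo 0 1) ∧
      ∫ x in Set.Ioo 0 1, betaKernel γ δ x * pfaffDiag a a' b b' γ x =
        pfaffDiagIntegral a a' b b' γ δ := by
  obtain ⟨M, hM⟩ := exists_nat_gt (-a'.re)
  induction M generalizing a' b' γ δ with
  | zero => exact integral_pfaffDiag_of_re_pos hγ hδ hδ' he (by simpa using hM)
  | succ M ih =>
    push_cast at hM
    have h1 := ih (a' := a' + 1) (b' := b') (γ := γ) (δ := δ + 1) hγ (by simp; linarith)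
      (by convert hδ' using 2; ring) (by convert he using 2; ring) (by simp; linarith)
    have h2 := ih (a' := a' + 1) (b' := b' + 1) (γ := γ + 1) (δ := δ) (by simp; linarith) hδ
      (by convert hδ' using 2; ring) (by convert he using 2; ring) (by simp; linarith)
    have hE : Set.EqOn (fun x : ℝ => betaKernel γ δ x * pfaffDiag a a' b b' γ x)
        (fun x : ℝ => betaKernel γ (δ + 1) x * pfaffDiag a (a' + 1) b b' γ x +
          b' / γ * (betaKernel (γ + 1) δ x * pfaffDiag a (a' + 1) b (b' + 1) (γ + 1) x))
        (Set.Ioo 0 1) := by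
      intro x hx
      have hx1 : ‖(x : ℂ)‖ < 1 := by
        rw [Complex.norm_real, Real.norm_of_nonneg hx.1.le]; exact hx.2
      have h3 := betaKernel_mul_pow γ δ 1 hx
      rw [Nat.cast_one, pow_one] at h3
      simp only
      rw [pfaffDiag_contiguous a a' b b' hγ hx1, betaKernel_add_one_right _ _ hx, h3]
      ring
    refine ⟨(h1.1.add (h2.1.const_mul _)).congr_fun hE.symm measurableSet_Ioo, ?_⟩
    rw [setIntegral_congr_fun measurableSet_Ioo hE, integral_add h1.1 (h2.1.const_mul _),
      integral_const_mul, h1.2, h2.2, pfaffDiagIntegral_contiguous a a' b b' hγ hδ]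

/-! ### Analyticity of double power series -/

/-- The `m`-th unit vector of `ℓ^∞`. -/
def ellInftyBasis (m : ℕ) : BoundedContinuousFunction ℕ ℂ :=
  BoundedContinuousFunction.ofNormedAddCommGroupDiscrete (fun k => if k = m then 1 else 0) 1
    fun k => by split_ifs <;> simp

/-- The sequence `(1, w, w², …)`, as a point of `ℓ^∞` depending on `w` in the unit disc. -/
def geometricSeq (w : ℂ) : BoundedContinuousFunction ℕ ℂ := ∑' m : ℕ, w ^ m • ellInftyBasis m

theorem norm_ellInftyBasis_le (m : ℕ) : ‖ellInftyBasis m‖ ≤ 1 :=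
  (BoundedContinuousFunction.norm_le zero_le_one).2 fun k => by
    simp only [ellInftyBasis, BoundedContinuousFunction.coe_ofNormedAddCommGroupDiscrete]
    split_ifs <;> simp

theorem norm_pow_smul_ellInftyBasis_le (w : ℂ) (m : ℕ) : ‖w ^ m • ellInftyBasis m‖ ≤ ‖w‖ ^ m := by
  rw [norm_smul, norm_pow]
  exact mul_le_of_le_one_right (by positivity) (norm_ellInftyBasis_le m)

theorem geometricSeq_apply {w : ℂ} (hw : ‖w‖ < 1) (k : ℕ) : geometricSeq w k = w ^ k := by
  have hs : Summable fun m : ℕ => w ^ m • ellInftyBasis m :=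
    Summable.of_norm_bounded (summable_geometric_of_lt_one (norm_nonneg w) hw)
      (norm_pow_smul_ellInftyBasis_le w)
  have h1 := hs.hasSum.mapL (BoundedContinuousFunction.evalCLM ℂ k)
  have h2 : HasSum (fun m : ℕ => BoundedContinuousFunction.evalCLM ℂ k (w ^ m • ellInftyBasis m))
      (w ^ k) := by
    convert hasSum_single (f := fun m : ℕ =>
      BoundedContinuousFunction.evalCLM ℂ k (w ^ m • ellInftyBasis m)) k ?_ using 1
    · simp [ellInftyBasis]
    · intro m hm
      simp [ellInftyBasis, hm.symm]
  exact h1.unique h2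

theorem analyticAt_geometricSeq {w : ℂ} (hw : ‖w‖ < 1) : AnalyticAt ℂ geometricSeq w := by
  obtain ⟨ρ, h1, h2⟩ := exists_between hw
  have hρ : 0 ≤ ρ := (norm_nonneg w).trans h1.le
  have hd : DifferentiableOn ℂ geometricSeq (Metric.ball 0 ρ) := by
    refine Complex.differentiableOn_tsum_of_summable_norm (summable_geometric_of_lt_one hρ h2)
      (fun m => ?_) Metric.isOpen_ball fun m z hz => ?_
    · exact ((differentiable_id.pow m).smul_const _).differentiableOn
    · rw [mem_ball_zero_iff] at hz
      exact (norm_pow_smul_ellInftyBasis_le z m).trans (pow_le_pow_left₀ (norm_nonneg z) hz.le m)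
  exact hd.analyticAt (Metric.isOpen_ball.mem_nhds (mem_ball_zero_iff.2 h1))

/-- An absolutely summable double sequence of coefficients defines a continuous bilinear form. -/
theorem exists_bilinear_hasSum {E : Type*} [NormedAddCommGroup E] [NormedSpace ℂ E]
    {ev : ℕ → E →L[ℂ] ℂ} (hev : ∀ m, ‖ev m‖ ≤ 1) {c : ℕ × ℕ → ℂ} (hc : Summable fun p => ‖c p‖) :
    ∃ S : E →L[ℂ] E →L[ℂ] ℂ, ∀ x y, HasSum (fun p => c p * ev p.1 x * ev p.2 y) (S x y) := by
  have hT : Summable fun p : ℕ × ℕ => (c p • ev p.1).smulRight (ev p.2) := by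
    refine Summable.of_norm_bounded (E := E →L[ℂ] E →L[ℂ] ℂ) hc fun p => ?_
    rw [ContinuousLinearMap.norm_smulRight_apply, norm_smul, mul_assoc]
    exact mul_le_of_le_one_right (norm_nonneg _) (mul_le_one₀ (hev _) (norm_nonneg _) (hev _))
  refine ⟨∑' p : ℕ × ℕ, (c p • ev p.1).smulRight (ev p.2), fun x y => ?_⟩
  have h := (hT.hasSum.mapL (ContinuousLinearMap.apply ℂ (E →L[ℂ] ℂ) x)).mapL
    (ContinuousLinearMap.apply ℂ ℂ y)
  refine h.congr_fun fun p => ?_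
  simp [mul_assoc]

/-- A double power series is analytic inside any polydisc on which it converges absolutely: up to
scaling it is a continuous bilinear form on `ℓ^∞`, evaluated at two geometric sequences. -/
theorem analyticAt_double_powerSeries {c : ℕ × ℕ → ℂ} {r : ℝ}
    (hc : Summable fun p : ℕ × ℕ => ‖c p‖ * r ^ (p.1 + p.2)) {q : ℂ × ℂ} (h1 : ‖q.1‖ < r)
    (h2 : ‖q.2‖ < r) :
    AnalyticAt ℂ (fun q : ℂ × ℂ => ∑' p : ℕ × ℕ, c p * q.1 ^ p.1 * q.2 ^ p.2) q := by
  have hr : 0 < r := (norm_nonneg _).trans_lt h1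
  have hr0 : (r : ℂ) ≠ 0 := by exact_mod_cast hr.ne'
  have hc' : Summable fun p : ℕ × ℕ => ‖c p * (r : ℂ) ^ (p.1 + p.2)‖ := by
    simpa only [norm_mul, norm_pow, Complex.norm_real, Real.norm_of_nonneg hr.le] using hc
  have hev : ∀ m : ℕ, ‖BoundedContinuousFunction.evalCLM (β := ℂ) ℂ m‖ ≤ 1 := fun m =>
    ContinuousLinearMap.opNorm_le_bound _ zero_le_one fun f => by
      rw [one_mul]; exact f.norm_coe_le_norm m
  obtain ⟨S, hS⟩ := exists_bilinear_hasSum hev hc'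
  have hlt : ∀ {z : ℂ}, ‖z‖ < r → ‖z / r‖ < 1 := fun {z} hz => by
    rwa [norm_div, Complex.norm_real, Real.norm_of_nonneg hr.le, div_lt_one hr]
  have hval : ∀ z : ℂ × ℂ, ‖z.1‖ < r → ‖z.2‖ < r →
      S (geometricSeq (z.1 / r)) (geometricSeq (z.2 / r)) =
        ∑' p : ℕ × ℕ, c p * z.1 ^ p.1 * z.2 ^ p.2 := by
    intro z hz1 hz2
    refine ((hS _ _).tsum_eq.symm.trans (tsum_congr fun p => ?_))
    rw [BoundedContinuousFunction.evalCLM_apply, BoundedContinuousFunction.evalCLM_apply,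
      geometricSeq_apply (hlt hz1), geometricSeq_apply (hlt hz2), div_pow, div_pow, pow_add]
    field_simp
  have hA : AnalyticAt ℂ (fun z : ℂ × ℂ =>
      S (geometricSeq (z.1 / r)) (geometricSeq (z.2 / r))) q := by
    have g1 : AnalyticAt ℂ (fun z : ℂ × ℂ => geometricSeq (z.1 / r)) q :=
      (analyticAt_geometricSeq (hlt h1)).comp_of_eq (analyticAt_fst.div_const) rfl
    have g2 : AnalyticAt ℂ (fun z : ℂ × ℂ => geometricSeq (z.2 / r)) q :=
      (analyticAt_geometricSeq (hlt h2)).comp_of_eq (analyticAt_snd.div_const) rfl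
    exact (ContinuousLinearMap.analyticAt_bilinear S _).comp_of_eq (g1.prod g2) rfl
  refine hA.congr ?_
  have o1 : ∀ᶠ z : ℂ × ℂ in 𝓝 q, ‖z.1‖ < r :=
    (continuous_fst.norm.continuousAt).eventually_lt continuousAt_const h1
  have o2 : ∀ᶠ z : ℂ × ℂ in 𝓝 q, ‖z.2‖ < r :=
    (continuous_snd.norm.continuousAt).eventually_lt continuousAt_const h2
  filter_upwards [o1, o2] with z hz1 hz2
  exact hval z hz1 hz2

/-- The analytic continuation of Appell's function given by Pfaff's transformation in `Y`. -/
def appellF3Pfaff (a a' b b' γ : ℂ) (q : ℂ × ℂ) : ℂ :=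
  (1 - q.2) ^ (-a') * ∑' p : ℕ × ℕ, pfaffCoeff a a' b b' γ p * q.1 ^ p.1 * (q.2 / (q.2 - 1)) ^ p.2

theorem norm_div_sub_one_lt_one {Y : ℂ} (hY : Y.re < 1 / 2) : ‖Y / (Y - 1)‖ < 1 := by
  have h0 : Y - 1 ≠ 0 := fun h => by
    rw [sub_eq_zero.1 h] at hY; norm_num at hY
  rw [norm_div, div_lt_one (norm_pos_iff.2 h0), Complex.norm_def, Complex.norm_def]
  refine Real.sqrt_lt_sqrt (Complex.normSq_nonneg _) ?_
  rw [Complex.normSq_apply, Complex.normSq_apply]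
  simp only [Complex.sub_re, Complex.one_re, Complex.sub_im, Complex.one_im, sub_zero]
  nlinarith

theorem analyticOnNhd_appellF3Pfaff (a a' b b' : ℂ) {γ : ℂ} (hγ : 0 < γ.re) :
    AnalyticOnNhd ℂ (appellF3Pfaff a a' b b' γ) appellF3Domain := by
  rintro q ⟨hX, hY⟩
  have hZ := norm_div_sub_one_lt_one hY
  obtain ⟨r, hr, hr1⟩ := exists_between (max_lt hX hZ)
  rw [max_lt_iff] at hr
  have hr0 : 0 ≤ r := (norm_nonneg _).trans hr.1.le
  have h0 : q.2 - 1 ≠ 0 := fun h => by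
    rw [sub_eq_zero.1 h] at hY; norm_num at hY
  have hs := summable_norm_pfaffCoeff_mul_pow a a' b b' γ hγ hr0 hr1
  have hmap : AnalyticAt ℂ (fun q : ℂ × ℂ => (q.1, q.2 / (q.2 - 1))) q :=
    analyticAt_fst.prod (analyticAt_snd.div (analyticAt_snd.sub analyticAt_const) h0)
  refine AnalyticAt.mul ?_ ?_
  · refine (analyticAt_const.sub analyticAt_snd).cpow analyticAt_const (Or.inl ?_)
    simp only [Pi.sub_apply, Complex.sub_re, Complex.one_re]
    linarith
  · exact (analyticAt_double_powerSeries hs (q := (q.1, q.2 / (q.2 - 1))) hr.1 hr.2).comp_of_eq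
      hmap rfl

/-! ### Pfaff's transformation -/

/-- The Chu–Vandermonde identity. -/
theorem sum_antidiagonal_choose_mul_poch (B c : ℂ) (N : ℕ) :
    ∑ p ∈ Finset.HasAntidiagonal.antidiagonal N,
      (N.choose p.1 : ℂ) * ((-1) ^ p.1 * poch B p.1 * poch (c + p.1) p.2) = poch (c - B) N := by
  induction N generalizing c with
  | zero => simp
  | succ N ih =>
    rw [Finset.sum_antidiagonal_choose_succ_mul
      (fun i j => (-1) ^ i * poch B i * poch (c + i) j) N, poch_succ_left,
      show c - B + 1 = c + 1 - B by ring, ← ih (c + 1), Finset.mul_sum, ← Finset.sum_add_distrib]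
    refine Finset.sum_congr rfl fun p hp => ?_
    have hp' := Finset.HasAntidiagonal.mem_antidiagonal.1 hp
    have e1 : N.choose p.2 = N.choose p.1 := by
      rw [← hp']; exact (Nat.choose_symm_add).symm
    have e2 : c + ((p.1 + 1 : ℕ) : ℂ) = c + p.1 + 1 := by push_cast; ring
    rw [e1, e2, add_right_comm c 1, poch_succ_left (c + p.1), poch_succ B, pow_succ]
    ring

theorem hasSum_one_sub_cpow_neg (a : ℂ) {z : ℂ} (hz : ‖z‖ < 1) :
    HasSum (fun k : ℕ => poch a k / k.factorial * z ^ k) ((1 - z) ^ (-a)) := by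
  have h := (Complex.one_div_one_sub_cpow_hasFPowerSeriesOnBall_zero a).hasSum (y := z) (by
    simpa [enorm_eq_nnnorm] using! hz)
  rw [zero_add, one_div, ← Complex.cpow_neg] at h
  refine h.congr_fun fun k => ?_
  have h1 := Ring.factorial_nsmul_multichoose_eq_ascPochhammer a k
  rw [Polynomial.ascPochhammer_smeval_eq_eval, nsmul_eq_mul] at h1
  have h2 : Ring.choose (a + k - 1) k = Ring.multichoose a k := by
    rw [Ring.choose]; congr 1; ring
  have h3 : (k.factorial : ℂ) ≠ 0 := by exact_mod_cast k.factorial_ne_zero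
  simp only [FormalMultilinearSeries.ofScalars_apply_eq, smul_eq_mul, h2]
  rw [poch, ← h1]
  field_simp

theorem tsum_prod_eq_tsum_sum_antidiagonal {f : ℕ × ℕ → ℂ} (hf : Summable f) :
    ∑' p, f p = ∑' N, ∑ p ∈ Finset.HasAntidiagonal.antidiagonal N, f p := by
  rw [← Finset.HasAntidiagonal.sigmaAntidiagonalEquivProd.tsum_eq f]
  have hs := Finset.HasAntidiagonal.sigmaAntidiagonalEquivProd.summable_iff.2 hf
  refine (hs.tsum_sigma' fun N => (hasSum_fintype _).summable).trans ?_
  refine tsum_congr fun N => ?_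
  rw [tsum_fintype]
  exact Finset.sum_coe_sort (Finset.HasAntidiagonal.antidiagonal N) f

/-- Expanding the powers of `1 - Y` in Pfaff's transformation gives an absolutely convergent double
series for `|Y| < 1 / 2`: binomial coefficients of `m + n` are at most `2 ^ (m + n)`. -/
theorem summable_pfaff_double (a' b' : ℂ) {c : ℂ} (hc : 0 < c.re) {Y : ℂ} (hY : ‖Y‖ < 1 / 2) :
    Summable fun p : ℕ × ℕ => poch a' (p.1 + p.2) / (p.1.factorial * p.2.factorial) *
      (poch b' p.1 / poch c p.1) * (-1) ^ p.1 * Y ^ (p.1 + p.2) := by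
  obtain ⟨C₁, hC₁, h₁⟩ := exists_norm_poch_div_factorial_le a'
  obtain ⟨C₂, hC₂, h₂⟩ := exists_norm_poch_div_le' c b' hc
  have hr0 : 0 ≤ 2 * ‖Y‖ := by positivity
  have hr1 : 2 * ‖Y‖ < 1 := by linarith
  have hs := ((summable_rpow_mul_geometric (|a'.re - 1| + (b'.re - c.re)) hr0 hr1).mul_of_nonneg
    (summable_rpow_mul_geometric |a'.re - 1| hr0 hr1) (fun k => by positivity)
    (fun k => by positivity)).mul_left (C₁ * C₂)
  refine Summable.of_norm_bounded hs fun p => ?_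
  have hf : ∀ k : ℕ, (k.factorial : ℂ) ≠ 0 := fun k => by exact_mod_cast k.factorial_ne_zero
  have e : poch a' (p.1 + p.2) / (p.1.factorial * p.2.factorial : ℂ) =
      poch a' (p.1 + p.2) / (p.1 + p.2).factorial * ((p.1 + p.2).choose p.1 : ℂ) := by
    have := Nat.add_choose_mul_factorial_mul_factorial p.1 p.2
    rw [← Nat.choose_symm_add] at this
    have h2 : ((p.1 + p.2).choose p.1 : ℂ) * p.1.factorial * p.2.factorial =
      (p.1 + p.2).factorial := by exact_mod_cast this
    have := hf p.1
    have := hf p.2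
    have := hf (p.1 + p.2)
    field_simp
    rw [← h2]
    ring
  have hch : ‖((p.1 + p.2).choose p.1 : ℂ)‖ ≤ 2 ^ (p.1 + p.2) := by
    rw [Complex.norm_natCast]
    exact_mod_cast Nat.choose_le_two_pow _ _
  have h1 : ‖poch a' (p.1 + p.2) / (p.1 + p.2).factorial‖ ≤
      C₁ * (((p.1 : ℝ) + 1) ^ |a'.re - 1| * ((p.2 : ℝ) + 1) ^ |a'.re - 1|) := by
    refine (h₁ _).trans ?_
    gcongr
    rw [← Real.mul_rpow (by positivity) (by positivity)]
    refine (Real.rpow_le_rpow_of_exponent_le (by linarith [(p.1 + p.2).cast_nonneg (α := ℝ)])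
      (le_abs_self _)).trans ?_
    refine Real.rpow_le_rpow (by positivity) ?_ (abs_nonneg _)
    push_cast
    nlinarith [mul_nonneg (p.1.cast_nonneg (α := ℝ)) (p.2.cast_nonneg (α := ℝ))]
  rw [e]
  simp only [norm_mul, norm_pow, norm_neg, norm_one, one_pow, mul_one]
  calc _ ≤ C₁ * (((p.1 : ℝ) + 1) ^ |a'.re - 1| * ((p.2 : ℝ) + 1) ^ |a'.re - 1|) *
        2 ^ (p.1 + p.2) * (C₂ * ((p.1 : ℝ) + 1) ^ (b'.re - c.re)) * ‖Y‖ ^ (p.1 + p.2) := by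
        gcongr
        exact h₂ _
    _ = _ := by
        rw [Real.rpow_add (x := (p.1 : ℝ) + 1) (by positivity), pow_add, pow_add, mul_pow, mul_pow]
        ring

/-- **Pfaff's transformation** of `₂F₁(a', b'; c; Y)`, for small `Y`. -/
theorem tsum_pfaff (a' b' : ℂ) {c : ℂ} (hc : 0 < c.re) {Y : ℂ} (hY : ‖Y‖ < 1 / 2) :
    ∑' n : ℕ, poch a' n / n.factorial * (poch b' n / poch c n) * Y ^ n =
      (1 - Y) ^ (-a') * ∑' n : ℕ, poch a' n / n.factorial * (poch (c + -b') n / poch c n) *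
        (Y / (Y - 1)) ^ n := by
  have hf : ∀ k : ℕ, (k.factorial : ℂ) ≠ 0 := fun k => by exact_mod_cast k.factorial_ne_zero
  have hs := summable_pfaff_double a' (c + -b') hc hY
  have h1Y : 1 - Y ≠ 0 := fun h => by
    rw [← sub_eq_zero.1 h] at hY; norm_num at hY
  have h1 : ∑' p : ℕ × ℕ, poch a' (p.1 + p.2) / (p.1.factorial * p.2.factorial) *
      (poch (c + -b') p.1 / poch c p.1) * (-1) ^ p.1 * Y ^ (p.1 + p.2) =
      (1 - Y) ^ (-a') * ∑' n : ℕ, poch a' n / n.factorial * (poch (c + -b') n / poch c n) *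
        (Y / (Y - 1)) ^ n := by
    rw [hs.tsum_prod, ← tsum_mul_left]
    refine tsum_congr fun n => ?_
    have h2 := (hasSum_one_sub_cpow_neg (a' + n) (z := Y) (by linarith)).mul_left
      (poch a' n / n.factorial * (poch (c + -b') n / poch c n) * (-1) ^ n * Y ^ n)
    have h3 : (1 - Y) ^ (-(a' + n)) = (1 - Y) ^ (-a') / (1 - Y) ^ n := by
      rw [neg_add, Complex.cpow_add _ _ h1Y, Complex.cpow_neg _ (n : ℂ), Complex.cpow_natCast]
      rfl
    have h4 : Y / (Y - 1) = -1 * Y / (1 - Y) := by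
      rw [← neg_sub 1 Y, div_neg]; ring
    calc _ = ∑' k : ℕ, poch a' n / n.factorial * (poch (c + -b') n / poch c n) * (-1) ^ n *
          Y ^ n * (poch (a' + n) k / k.factorial * Y ^ k) := by
          refine tsum_congr fun k => ?_
          rw [poch_add a', pow_add]
          simp only
          field_simp
      _ = _ := by
          rw [h2.tsum_eq, h3, h4, div_pow, mul_pow]
          ring
  -- The coefficient of `Y ^ N` is evaluated by the Chu–Vandermonde identity.
  rw [← h1, tsum_prod_eq_tsum_sum_antidiagonal hs]
  refine tsum_congr fun N => ?_
  have h2 := sum_antidiagonal_choose_mul_poch (c + -b') c N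
  rw [show c - (c + -b') = b' by ring] at h2
  rw [← h2, Finset.sum_div, Finset.mul_sum, Finset.sum_mul]
  refine Finset.sum_congr rfl fun p hp => ?_
  have hp' := Finset.HasAntidiagonal.mem_antidiagonal.1 hp
  have h3 : ((p.1 + p.2).choose p.1 : ℂ) = (p.1 + p.2).factorial /
      (p.1.factorial * p.2.factorial) := by
    have := Nat.add_choose_mul_factorial_mul_factorial p.1 p.2
    rw [← Nat.choose_symm_add] at this
    rw [eq_div_iff (mul_ne_zero (hf _) (hf _)), ← mul_assoc]
    exact_mod_cast this
  have h4 : poch c p.1 ≠ 0 := poch_ne_zero_of_re_pos hc _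
  have h5 : poch (c + p.1) p.2 ≠ 0 := poch_ne_zero_of_re_pos (by simp; positivity) _
  have := hf (p.1 + p.2)
  rw [← hp', h3, poch_add c]
  field_simp

theorem summable_appellF3Series (a a' b b' : ℂ) {γ : ℂ} (hγ : 0 < γ.re) {q : ℂ × ℂ}
    (h1 : ‖q.1‖ < 1) (h2 : ‖q.2‖ < 1) :
    Summable fun k : ℕ × ℕ => poch a k.1 * poch a' k.2 * poch b k.1 * poch b' k.2 /
      (poch γ (k.1 + k.2) * (k.1.factorial : ℂ) * (k.2.factorial : ℂ)) * q.1 ^ k.1 * q.2 ^ k.2 := by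
  obtain ⟨C₁, hC₁, h₁⟩ := exists_norm_poch_div_factorial_le a
  obtain ⟨C₂, hC₂, h₂⟩ := exists_norm_poch_div_le' γ b hγ
  obtain ⟨C₃, hC₃, h₃⟩ := exists_norm_poch_div_factorial_le a'
  obtain ⟨C₄, hC₄, h₄⟩ := exists_norm_poch_div_le' γ b' hγ
  have hs := ((summable_rpow_mul_geometric ((a.re - 1) + (b.re - γ.re)) (norm_nonneg q.1)
    h1).mul_of_nonneg (summable_rpow_mul_geometric ((a'.re - 1) + (b'.re - γ.re)) (norm_nonneg q.2)
    h2) (fun k => by positivity) (fun k => by positivity)).mul_left (C₁ * C₂ * C₃ * C₄)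
  refine Summable.of_norm_bounded hs fun p => ?_
  have h5 : poch γ p.2 ≠ 0 := poch_ne_zero_of_re_pos hγ _
  have e : poch a p.1 * poch a' p.2 * poch b p.1 * poch b' p.2 /
      (poch γ (p.1 + p.2) * (p.1.factorial : ℂ) * (p.2.factorial : ℂ)) * q.1 ^ p.1 * q.2 ^ p.2 =
      (poch a p.1 / p.1.factorial) * (poch b p.1 / poch γ p.1) * (poch a' p.2 / p.2.factorial) *
        (poch b' p.2 / poch γ p.2 * (poch γ p.2 / poch (γ + p.1) p.2)) *
        (q.1 ^ p.1 * q.2 ^ p.2) := by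
    rw [poch_add, div_mul_div_cancel₀ h5]
    ring
  have h6 : ‖poch γ p.2 / poch (γ + p.1) p.2‖ ≤ 1 := by
    rw [norm_div]
    exact div_le_one_of_le₀ (norm_poch_le_norm_poch_add hγ _ _) (norm_nonneg _)
  rw [e]
  simp only [norm_mul, norm_pow]
  calc _ ≤ (C₁ * ((p.1 : ℝ) + 1) ^ (a.re - 1)) * (C₂ * ((p.1 : ℝ) + 1) ^ (b.re - γ.re)) *
        (C₃ * ((p.2 : ℝ) + 1) ^ (a'.re - 1)) *
        ((C₄ * ((p.2 : ℝ) + 1) ^ (b'.re - γ.re)) * 1) * (‖q.1‖ ^ p.1 * ‖q.2‖ ^ p.2) := by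
        gcongr
        · exact h₁ _
        · exact h₂ _
        · exact h₃ _
        · exact h₄ _
    _ = _ := by
        rw [Real.rpow_add (x := (p.1 : ℝ) + 1) (by positivity),
          Real.rpow_add (x := (p.2 : ℝ) + 1) (by positivity)]
        ring

theorem appellF3Series_eq_appellF3Pfaff (a a' b b' : ℂ) {γ : ℂ} (hγ : 0 < γ.re) {q : ℂ × ℂ}
    (h1 : ‖q.1‖ < 1) (h2 : ‖q.2‖ < 1 / 2) :
    appellF3Series a a' b b' γ q = appellF3Pfaff a a' b b' γ q := by
  have hZ : ‖q.2 / (q.2 - 1)‖ < 1 :=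
    norm_div_sub_one_lt_one ((Complex.re_le_norm _).trans_lt h2)
  obtain ⟨r, hr, hr1⟩ := exists_between (max_lt h1 hZ)
  rw [max_lt_iff] at hr
  have hr0 : 0 ≤ r := (norm_nonneg _).trans hr.1.le
  have hs1 := summable_appellF3Series a a' b b' hγ h1 (h2.trans (by norm_num))
  have hs2 : Summable fun p : ℕ × ℕ =>
      pfaffCoeff a a' b b' γ p * q.1 ^ p.1 * (q.2 / (q.2 - 1)) ^ p.2 := by
    refine Summable.of_norm_bounded (summable_norm_pfaffCoeff_mul_pow a a' b b' γ hγ hr0 hr1)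
      fun p => ?_
    rw [norm_mul, norm_mul, norm_pow, norm_pow, pow_add, mul_assoc]
    gcongr
    · exact hr.1.le
    · exact hr.2.le
  rw [appellF3Series, appellF3Pfaff, hs1.tsum_prod, hs2.tsum_prod, ← tsum_mul_left]
  refine tsum_congr fun m => ?_
  have hγm : 0 < (γ + m).re := by simp; positivity
  have h3 := tsum_pfaff a' b' hγm h2
  calc _ = poch a m * poch b m / (poch γ m * m.factorial) * q.1 ^ m *
        ∑' n : ℕ, poch a' n / n.factorial * (poch b' n / poch (γ + m) n) * q.2 ^ n := by
        rw [← tsum_mul_left]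
        refine tsum_congr fun n => ?_
        rw [poch_add]
        ring
    _ = (1 - q.2) ^ (-a') * (poch a m * poch b m / (poch γ m * m.factorial) * q.1 ^ m *
        ∑' n : ℕ, poch a' n / n.factorial * (poch (γ + m + -b') n / poch (γ + m) n) *
          (q.2 / (q.2 - 1)) ^ n) := by
        rw [h3]
        ring
    _ = _ := by
        rw [← tsum_mul_left]
        congr 1
        refine tsum_congr fun n => ?_
        rw [pfaffCoeff, add_right_comm γ]
        ring

theorem isAppellF3Continuation_appellF3Pfaff (a a' b b' : ℂ) {γ : ℂ} (hγ : 0 < γ.re) :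
    IsAppellF3Continuation a a' b b' γ (appellF3Pfaff a a' b b' γ) where
  analytic := analyticOnNhd_appellF3Pfaff a a' b b' hγ
  eventuallyEq := by
    have o1 : ∀ᶠ z : ℂ × ℂ in 𝓝 (0, 0), ‖z.1‖ < 1 :=
      (continuous_fst.norm.continuousAt).eventually_lt continuousAt_const (by simp)
    have o2 : ∀ᶠ z : ℂ × ℂ in 𝓝 (0, 0), ‖z.2‖ < 1 / 2 :=
      (continuous_snd.norm.continuousAt).eventually_lt continuousAt_const (by simp)
    filter_upwards [o1, o2] with z hz1 hz2
    exact (appellF3Series_eq_appellF3Pfaff a a' b b' hγ hz1 hz2).symm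

/-! ### Power functions and odd entire functions -/

theorem ofReal_cpow_eq_exp {r : ℝ} (hr : 0 < r) (z : ℂ) :
    (r : ℂ) ^ z = Complex.exp (Real.log r * z) := by
  rw [Complex.cpow_def_of_ne_zero (by exact_mod_cast hr.ne'), Complex.ofReal_log hr.le]

/-- On the curve `X = w`, `Y = 1 - 1 / (1 - w)` the two variables of the transformed series both
equal `w`. -/
theorem appellF3_eq_pfaffDiag (a a' b b' : ℂ) {γ : ℂ} (hγ : 0 < γ.re) {w : ℝ}
    (hw : w ∈ Set.Ioo (0 : ℝ) 1) :
    appellF3 a a' b b' γ (w : ℂ) (1 - 1 / (1 - w : ℝ)) =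
      ((1 - w : ℝ) : ℂ) ^ a' * pfaffDiag a a' b b' γ w := by
  have hs : 0 < 1 - w := by linarith [hw.2]
  have hs0 : ((1 - w : ℝ) : ℂ) ≠ 0 := by exact_mod_cast hs.ne'
  have hdom : ((w : ℂ), (1 - 1 / (1 - w : ℝ) : ℂ)) ∈ appellF3Domain := by
    refine ⟨?_, ?_⟩
    · rw [Complex.norm_real, Real.norm_of_nonneg hw.1.le]
      exact hw.2
    · have h1 : 1 - 1 / (1 - w) < 1 / 2 := by
        have : 1 < 1 / (1 - w) := by rw [lt_div_iff₀ hs]; linarith [hw.1]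
        linarith
      have h2 : (1 - 1 / (1 - w : ℝ) : ℂ) = ((1 - 1 / (1 - w) : ℝ) : ℂ) := by push_cast; ring
      simp only [h2, Complex.ofReal_re]
      exact h1
  rw [(isAppellF3Continuation_appellF3Pfaff a a' b b' hγ).appellF3_eq hdom, appellF3Pfaff,
    pfaffDiag]
  have e1 : (1 - 1 / (1 - w : ℝ) : ℂ) / ((1 - 1 / (1 - w : ℝ) : ℂ) - 1) = w := by
    push_cast at hs0 ⊢
    rw [sub_sub_cancel_left, div_neg]
    field_simp
    ring
  have e2 : (1 - (1 - 1 / ((1 - w : ℝ) : ℂ))) ^ (-a') = ((1 - w : ℝ) : ℂ) ^ a' := by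
    have : (1 - (1 - 1 / ((1 - w : ℝ) : ℂ))) = (((1 - w)⁻¹ : ℝ) : ℂ) := by push_cast; ring
    rw [this, ofReal_cpow_eq_exp (inv_pos.2 hs), ofReal_cpow_eq_exp hs, Real.log_inv]
    push_cast
    ring_nf
  simp only
  rw [e1, e2]
  congr 1
  refine tsum_congr fun p => ?_
  rw [pow_add]
  ring

/-- The substitution `t = x / (1 - w)` turns the integral of a power function into a
beta integral. -/
theorem msmRightIntegrand_rpow_comp (α α' β β' ρ : ℂ) {γ : ℂ} (hγ : 0 < γ.re) {x : ℝ} (hx : 0 < x)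
    {w : ℝ} (hw : w ∈ Set.Ioo (0 : ℝ) 1) :
    |x / (1 - w) ^ 2| • msmRightIntegrand α α' β β' γ (fun t => (t : ℂ) ^ (ρ - 1)) x (x / (1 - w)) =
      (x : ℂ) ^ (γ + ρ - α - 1) *
        (betaKernel γ (α + α' - γ - ρ + 1) w * pfaffDiag α α' β β' γ w) := by
  have hs : 0 < 1 - w := by linarith [hw.2]
  have hs0 : ((1 - w : ℝ) : ℂ) ≠ 0 := by exact_mod_cast hs.ne'
  have hx0 : (x : ℂ) ≠ 0 := by exact_mod_cast hx.ne'
  have e1 : (1 : ℂ) - (x : ℂ) / ((x / (1 - w) : ℝ) : ℂ) = w := by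
    push_cast at hs0 ⊢
    field_simp
    ring
  have e2 : (1 : ℂ) - ((x / (1 - w) : ℝ) : ℂ) / (x : ℂ) = 1 - 1 / ((1 - w : ℝ) : ℂ) := by
    push_cast at hs0 ⊢
    field_simp
  have e3 : x / (1 - w) - x = x * w / (1 - w) := by field_simp; ring
  have e4 : (1 : ℂ) - w = ((1 - w : ℝ) : ℂ) := by push_cast; ring
  have hlog1 : Real.log (x / (1 - w)) = Real.log x - Real.log (1 - w) :=
    Real.log_div hx.ne' hs.ne'
  have hlog2 : Real.log (x * w / (1 - w)) = Real.log x + Real.log w - Real.log (1 - w) := by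
    rw [Real.log_div (mul_pos hx hw.1).ne' hs.ne', Real.log_mul hx.ne' hw.1.ne']
  have habs : ((|x / (1 - w) ^ 2| : ℝ) : ℂ) =
      Complex.exp (Real.log x - 2 * Real.log (1 - w)) := by
    rw [abs_of_pos (by positivity), ← Real.exp_log (show 0 < x / (1 - w) ^ 2 by positivity),
      Real.log_div hx.ne' (by positivity), Real.log_pow]
    push_cast
    rfl
  have hxw : 0 < x * w / (1 - w) := div_pos (mul_pos hx hw.1) hs
  rw [Complex.real_smul, msmRightIntegrand, e1, e2, appellF3_eq_pfaffDiag α α' β β' hγ hw, e3,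
    betaKernel, e4, habs, ofReal_cpow_eq_exp hxw, ofReal_cpow_eq_exp (div_pos hx hs),
    ofReal_cpow_eq_exp (div_pos hx hs), ofReal_cpow_eq_exp hs, ofReal_cpow_eq_exp hs,
    ofReal_cpow_eq_exp hx, ofReal_cpow_eq_exp hw.1, hlog1, hlog2]
  set P := pfaffDiag α α' β β' γ w
  have hexp : ∀ u₁ u₂ u₃ u₄ u₅ v₁ v₂ v₃ : ℂ, u₁ + u₂ + u₃ + u₄ + u₅ = v₁ + v₂ + v₃ →
      Complex.exp u₁ * (Complex.exp u₂ * Complex.exp u₃ * (Complex.exp u₄ * P) * Complex.exp u₅) =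
        Complex.exp v₁ * (Complex.exp v₂ * Complex.exp v₃ * P) := by
    intro u₁ u₂ u₃ u₄ u₅ v₁ v₂ v₃ h
    have h' := congrArg Complex.exp h
    simp only [Complex.exp_add] at h'
    linear_combination P * h'
  apply hexp
  push_cast
  ring

theorem image_div_one_sub_Ioo {x : ℝ} (hx : 0 < x) :
    (fun w : ℝ => x / (1 - w)) '' Set.Ioo 0 1 = Set.Ioi x := by
  ext t
  constructor
  · rintro ⟨w, hw, rfl⟩
    have hs : 0 < 1 - w := by linarith [hw.2]
    simp only [Set.mem_Ioi]
    rw [lt_div_iff₀ hs]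
    nlinarith [hw.1]
  · intro ht
    have ht : x < t := ht
    have ht0 : 0 < t := hx.trans ht
    refine ⟨1 - x / t, ⟨?_, ?_⟩, ?_⟩
    · rw [sub_pos, div_lt_one ht0]; exact ht
    · have := div_pos hx ht0; linarith
    · simp only
      rw [sub_sub_cancel, div_div_cancel₀ hx.ne']

theorem integral_msmRightIntegrand_rpow {α α' β β' γ ρ : ℂ} (hγ : 0 < γ.re)
    (h₁ : 0 < (α + α' - γ - ρ + 1).re) (h₂ : 0 < (α + β' - γ - ρ + 1).re)
    (h₃ : 0 < (-β - ρ + 1).re) {x : ℝ} (hx : 0 < x) :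
    IntegrableOn (msmRightIntegrand α α' β β' γ (fun t => (t : ℂ) ^ (ρ - 1)) x) (Set.Ioi x) ∧
      ∫ t in Set.Ioi x, msmRightIntegrand α α' β β' γ (fun t => (t : ℂ) ^ (ρ - 1)) x t =
        (x : ℂ) ^ (γ + ρ - α - 1) * pfaffDiagIntegral α α' β β' γ (α + α' - γ - ρ + 1) := by
  have key := integral_pfaffDiag (a := α) (a' := α') (b := β) (b' := β') hγ h₁
    (by convert h₂ using 2; ring) (by convert h₃ using 2; ring)
  have hderiv : ∀ w ∈ Set.Ioo (0 : ℝ) 1,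
      HasDerivWithinAt (fun w : ℝ => x / (1 - w)) (x / (1 - w) ^ 2) (Set.Ioo 0 1) w := by
    intro w hw
    have hs : 1 - w ≠ 0 := by linarith [hw.2]
    have := ((hasDerivAt_const w x).div ((hasDerivAt_id w).const_sub 1) hs).hasDerivWithinAt
      (s := Set.Ioo 0 1)
    refine this.congr_deriv ?_
    simp
  have hinj : Set.InjOn (fun w : ℝ => x / (1 - w)) (Set.Ioo 0 1) := by
    intro u hu v hv h
    have hu' : 1 - u ≠ 0 := by linarith [hu.2]
    have hv' : 1 - v ≠ 0 := by linarith [hv.2]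
    simp only at h
    rw [div_eq_div_iff hu' hv'] at h
    have := mul_left_cancel₀ hx.ne' h
    linarith
  have hE : Set.EqOn (fun w : ℝ => |x / (1 - w) ^ 2| •
      msmRightIntegrand α α' β β' γ (fun t => (t : ℂ) ^ (ρ - 1)) x (x / (1 - w)))
      (fun w : ℝ => (x : ℂ) ^ (γ + ρ - α - 1) *
        (betaKernel γ (α + α' - γ - ρ + 1) w * pfaffDiag α α' β β' γ w)) (Set.Ioo 0 1) :=
    fun w hw => msmRightIntegrand_rpow_comp α α' β β' ρ hγ hx hw
  rw [← image_div_one_sub_Ioo hx,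
    integrableOn_image_iff_integrableOn_abs_deriv_smul measurableSet_Ioo hderiv hinj,
    integral_image_eq_integral_abs_deriv_smul measurableSet_Ioo hderiv hinj]
  refine ⟨IntegrableOn.congr_fun (key.1.const_mul _) hE.symm measurableSet_Ioo, ?_⟩
  rw [setIntegral_congr_fun measurableSet_Ioo hE, integral_const_mul, key.2]

/-- The duplication formula for Pochhammer symbols. -/
theorem poch_two_mul (s : ℂ) (k : ℕ) :
    poch s (2 * k) = 4 ^ k * (poch (s / 2) k * poch ((s + 1) / 2) k) := by
  induction k with
  | zero => simp
  | succ k ih =>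
    rw [show 2 * (k + 1) = 2 * k + 1 + 1 by ring, poch_succ, poch_succ, ih, poch_succ, poch_succ]
    push_cast
    ring

theorem factorial_two_mul_add_one (k : ℕ) :
    ((2 * k + 1).factorial : ℂ) = 4 ^ k * (poch (3 / 2) k * k.factorial) := by
  rw [← poch_one, poch_succ_left, poch_two_mul, ← poch_one k]
  norm_num
  ring

/-- Integration term by term, for a function with the expansion
`∑ ε ^ k z ^ (2 k + 1) / (2 k + 1)!`, evaluated at `z = c / t`. -/
theorem hasSum_msmRight_odd {α α' β β' γ ρ : ℂ} (c : ℂ) {ε : ℂ} (hε : ‖ε‖ ≤ 1) {S : ℂ → ℂ}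
    (hS : ∀ z, HasSum (fun k : ℕ => ε ^ k * (z ^ (2 * k + 1) / (2 * k + 1).factorial)) (S z))
    (hγ : 0 < γ.re) (h₁ : 0 < (α + α' - γ - ρ + 1).re) (h₂ : 0 < (α + β' - γ - ρ + 1).re)
    (h₃ : 0 < (-β - ρ + 1).re) {x : ℝ} (hx : 0 < x) :
    IntegrableOn (msmRightIntegrand α α' β β' γ (fun t => (t : ℂ) ^ ρ * S (c / t)) x)
      (Set.Ioi x) ∧
    HasSum (fun k : ℕ => ε ^ k * (c ^ (2 * k + 1) / (2 * k + 1).factorial) *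
      ((x : ℂ) ^ (γ + (ρ - (2 * k : ℕ)) - α - 1) *
        pfaffDiagIntegral α α' β β' γ (α + α' - γ - (ρ - (2 * k : ℕ)) + 1)))
      (∫ t in Set.Ioi x, msmRightIntegrand α α' β β' γ (fun t => (t : ℂ) ^ ρ * S (c / t)) x t) := by
  -- On `t > x` the factor `t ^ (-2 k)` is at most `x ^ (-2 k)`, so `G 0` dominates all terms.
  let G : ℕ → ℝ → ℂ := fun k => msmRightIntegrand α α' β β' γ
    (fun t => (t : ℂ) ^ (ρ - (2 * k : ℕ) - 1)) x
  have hG : ∀ k : ℕ, IntegrableOn (G k) (Set.Ioi x) ∧ ∫ t in Set.Ioi x, G k t =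
      (x : ℂ) ^ (γ + (ρ - (2 * k : ℕ)) - α - 1) *
        pfaffDiagIntegral α α' β β' γ (α + α' - γ - (ρ - (2 * k : ℕ)) + 1) := by
    intro k
    have hk : (0 : ℝ) ≤ (2 * k : ℕ) := Nat.cast_nonneg _
    refine integral_msmRightIntegrand_rpow hγ ?_ ?_ ?_ hx
    · simp only [Complex.add_re, Complex.sub_re, Complex.natCast_re, Complex.one_re] at h₁ ⊢
      linarith
    · simp only [Complex.add_re, Complex.sub_re, Complex.natCast_re, Complex.one_re] at h₂ ⊢
      linarith
    · simp only [Complex.add_re, Complex.sub_re, Complex.natCast_re, Complex.one_re] at h₃ ⊢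
      linarith
  have hGpow : ∀ k : ℕ, ∀ t ∈ Set.Ioi x, G k t = G 0 t / (t : ℂ) ^ (2 * k) := by
    intro k t ht
    have ht0 : (t : ℂ) ≠ 0 := by exact_mod_cast (hx.trans ht).ne'
    simp only [G, msmRightIntegrand]
    have : (t : ℂ) ^ (ρ - (2 * k : ℕ) - 1) = (t : ℂ) ^ (ρ - 1) / (t : ℂ) ^ (2 * k) := by
      rw [sub_right_comm, Complex.cpow_sub _ _ ht0, Complex.cpow_natCast]
    rw [this]
    simp only [mul_zero, Nat.cast_zero, sub_zero]
    ring
  have key := integrable_and_hasSum_integral (μ := volume.restrict (Set.Ioi x))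
    (F := fun (k : ℕ) (t : ℝ) => ε ^ k * (c ^ (2 * k + 1) / (2 * k + 1).factorial) * G k t)
    (f := msmRightIntegrand α α' β β' γ (fun t => (t : ℂ) ^ ρ * S (c / t)) x)
    (fun k => (hG k).1.const_mul _) ?_ ?_
  · refine ⟨key.1, key.2.congr_fun fun k => ?_⟩
    rw [integral_const_mul, (hG k).2]
  · have hs := ((Real.hasSum_sinh (‖c‖ / x)).summable.mul_left x).mul_right
      (∫ t in Set.Ioi x, ‖G 0 t‖)
    refine Summable.of_nonneg_of_le (fun k => integral_nonneg fun t => norm_nonneg _)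
      (fun k => ?_) hs
    rw [← integral_const_mul]
    refine setIntegral_mono_on ((hG k).1.const_mul _).norm ((hG 0).1.norm.const_mul _)
      measurableSet_Ioi fun t ht => ?_
    have ht0 : 0 < t := hx.trans ht
    have hxt : x ^ (2 * k) ≤ t ^ (2 * k) := pow_le_pow_left₀ hx.le (le_of_lt ht) _
    rw [hGpow k t ht, norm_mul, norm_mul, norm_pow, norm_div, norm_div, norm_pow, norm_pow,
      Complex.norm_natCast, Complex.norm_real, Real.norm_of_nonneg ht0.le]
    have e : x * ((‖c‖ / x) ^ (2 * k + 1) / ((2 * k + 1).factorial : ℝ)) * ‖G 0 t‖ =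
        1 * (‖c‖ ^ (2 * k + 1) / ((2 * k + 1).factorial : ℝ)) * (‖G 0 t‖ / x ^ (2 * k)) := by
      rw [div_pow, pow_succ x]
      field_simp
    rw [e]
    gcongr
    exact pow_le_one₀ (norm_nonneg _) hε
  · refine (ae_restrict_iff' measurableSet_Ioi).2 (Eventually.of_forall fun t ht => ?_)
    have ht0 : (t : ℂ) ≠ 0 := by exact_mod_cast (hx.trans ht).ne'
    have h := (hS (c / t)).mul_left (((t - x : ℝ) : ℂ) ^ (γ - 1) * (t : ℂ) ^ (-α) *
      appellF3 α α' β β' γ (1 - (x : ℂ) / (t : ℂ)) (1 - (t : ℂ) / (x : ℂ)) * (t : ℂ) ^ ρ)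
    have e : msmRightIntegrand α α' β β' γ (fun t => (t : ℂ) ^ ρ * S (c / t)) x t =
        ((t - x : ℝ) : ℂ) ^ (γ - 1) * (t : ℂ) ^ (-α) *
        appellF3 α α' β β' γ (1 - (x : ℂ) / (t : ℂ)) (1 - (t : ℂ) / (x : ℂ)) * (t : ℂ) ^ ρ *
          S (c / t) := by
      rw [msmRightIntegrand]; ring
    rw [e]
    refine h.congr_fun fun k => ?_
    rw [hGpow k t ht]
    simp only [G, msmRightIntegrand, mul_zero, Nat.cast_zero, sub_zero]
    rw [Complex.cpow_sub _ _ ht0, Complex.cpow_one, div_pow, pow_succ (t : ℂ)]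
    field_simp

/-- Replacing `ρ` by `ρ - 2 k` multiplies the value for a power function by Pochhammer symbols
of index `2 k`. -/
theorem pfaffDiagIntegral_sub_two_mul {α α' β β' γ ρ : ℂ}
    (h₁ : 0 < (α + α' - γ - ρ + 1).re) (h₂ : 0 < (α + β' - γ - ρ + 1).re)
    (h₃ : 0 < (-β - ρ + 1).re) (hden₁ : ∀ n : ℕ, 1 - ρ ≠ -(n : ℂ))
    (hden₂ : ∀ n : ℕ, α + α' + β' - γ - ρ + 1 ≠ -(n : ℂ))
    (hden₃ : ∀ n : ℕ, α - β - ρ + 1 ≠ -(n : ℂ)) (k : ℕ) :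
    pfaffDiagIntegral α α' β β' γ (α + α' - γ - (ρ - (2 * k : ℕ)) + 1) =
      Complex.Gamma γ * ((Complex.Gamma (α + α' - γ - ρ + 1) *
        Complex.Gamma (α + β' - γ - ρ + 1) * Complex.Gamma (-β - ρ + 1) /
          (Complex.Gamma (1 - ρ) * Complex.Gamma (α + α' + β' - γ - ρ + 1) *
            Complex.Gamma (α - β - ρ + 1))) *
        (poch (α + α' - γ - ρ + 1) (2 * k) * poch (α + β' - γ - ρ + 1) (2 * k) *
          poch (-β - ρ + 1) (2 * k) / (poch (1 - ρ) (2 * k) *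
            poch (α + α' + β' - γ - ρ + 1) (2 * k) * poch (α - β - ρ + 1) (2 * k)))) := by
  set N := 2 * k
  have e1 : α + α' - γ - (ρ - (N : ℕ)) + 1 = α + α' - γ - ρ + 1 + N := by ring
  have e2 : α + α' - γ - ρ + 1 + N + β' - α' = α + β' - γ - ρ + 1 + N := by ring
  have e3 : γ + (α + α' - γ - ρ + 1 + N) - α' - α - β = -β - ρ + 1 + N := by ring
  have e4 : α + α' - γ - ρ + 1 + N + β' = α + α' + β' - γ - ρ + 1 + N := by ring
  have e5 : γ + (α + α' - γ - ρ + 1 + N) - α' - α = 1 - ρ + N := by ring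
  have e6 : γ + (α + α' - γ - ρ + 1 + N) - α' - β = α - β - ρ + 1 + N := by ring
  rw [pfaffDiagIntegral, e1, e2, e3, e4, e5, e6, Gamma_add_nat (ne_neg_nat_of_re_pos h₁),
    Gamma_add_nat (ne_neg_nat_of_re_pos h₂), Gamma_add_nat (ne_neg_nat_of_re_pos h₃),
    Gamma_add_nat hden₁, Gamma_add_nat hden₂, Gamma_add_nat hden₃, div_mul_div_comm]
  congr 2 <;> ring

/-- The operator applied to `t ^ ρ S(c / t)`, where `S z = ∑ ε ^ k z ^ (2 k + 1) / (2 k + 1)!` is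
the sine for `ε = -1` and the hyperbolic sine for `ε = 1`. -/
theorem msmRight_odd {α α' β β' γ ρ : ℂ} (c : ℂ) {ε : ℂ} (hε : ‖ε‖ ≤ 1) {S : ℂ → ℂ}
    (hS : ∀ z, HasSum (fun k : ℕ => ε ^ k * (z ^ (2 * k + 1) / (2 * k + 1).factorial)) (S z))
    (hγ : 0 < γ.re) (hρ : ρ.re < 1 + min (-β).re (min (α + α' - γ).re (α + β' - γ).re))
    (hden₁ : ∀ n : ℕ, 1 - ρ ≠ -(n : ℂ))
    (hden₂ : ∀ n : ℕ, α + α' + β' - γ - ρ + 1 ≠ -(n : ℂ))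
    (hden₃ : ∀ n : ℕ, α - β - ρ + 1 ≠ -(n : ℂ)) {x : ℝ} (hx : 0 < x) :
    IntegrableOn (msmRightIntegrand α α' β β' γ (fun t => (t : ℂ) ^ ρ * S (c / t)) x)
      (Set.Ioi x) ∧
    msmRight α α' β β' γ (fun t => (t : ℂ) ^ ρ * S (c / t)) x =
      c * (Complex.Gamma (α + α' - γ - ρ + 1) * Complex.Gamma (α + β' - γ - ρ + 1) *
          Complex.Gamma (-β - ρ + 1) /
        (Complex.Gamma (1 - ρ) * Complex.Gamma (α + α' + β' - γ - ρ + 1) *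
          Complex.Gamma (α - β - ρ + 1))) *
      (x : ℂ) ^ (ρ - α - α' + γ - 1) *
      genHypergeometric
        [(α + α' - γ - ρ + 1) / 2, (α + α' - γ - ρ + 2) / 2,
          (α + β' - γ - ρ + 1) / 2, (α + β' - γ - ρ + 2) / 2,
          (-β - ρ + 1) / 2, (-β - ρ + 2) / 2]
        [3 / 2, (1 - ρ) / 2, (2 - ρ) / 2,
          (α + α' + β' - γ - ρ + 1) / 2, (α + α' + β' - γ - ρ + 2) / 2,
          (α - β - ρ + 1) / 2, (α - β - ρ + 2) / 2]
        (ε * (c ^ 2 / (4 * (x : ℂ) ^ 2))) := by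
  have hρ' : ρ.re - 1 < min (-β).re (min (α + α' - γ).re (α + β' - γ).re) := by linarith
  rw [lt_min_iff, lt_min_iff] at hρ'
  obtain ⟨r₃, r₁, r₂⟩ := hρ'
  simp only [Complex.add_re, Complex.sub_re, Complex.neg_re] at r₁ r₂ r₃
  have h₁ : 0 < (α + α' - γ - ρ + 1).re := by
    simp only [Complex.add_re, Complex.sub_re, Complex.one_re]; linarith
  have h₂ : 0 < (α + β' - γ - ρ + 1).re := by
    simp only [Complex.add_re, Complex.sub_re, Complex.one_re]; linarith
  have h₃ : 0 < (-β - ρ + 1).re := by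
    simp only [Complex.add_re, Complex.sub_re, Complex.neg_re, Complex.one_re]; linarith
  have key := hasSum_msmRight_odd (ρ := ρ) c hε hS hγ h₁ h₂ h₃ hx
  refine ⟨key.1, ?_⟩
  have hx0 : (x : ℂ) ≠ 0 := by exact_mod_cast hx.ne'
  have hΓ := Complex.Gamma_ne_zero_of_re_pos hγ
  rw [msmRight, ← key.2.tsum_eq, genHypergeometric, ← tsum_mul_left, ← tsum_mul_left]
  refine tsum_congr fun k => ?_
  rw [pfaffDiagIntegral_sub_two_mul h₁ h₂ h₃ hden₁ hden₂ hden₃ k]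
  simp only [poch_two_mul, factorial_two_mul_add_one, List.map_cons, List.map_nil, List.prod_cons,
    List.prod_nil, mul_one]
  have f1 : ∀ u : ℂ, u + 1 + 1 = u + 2 := fun u => by ring
  have f2 : 1 - ρ + 1 = 2 - ρ := by ring
  have hpow : (x : ℂ) ^ (γ + (ρ - (2 * k : ℕ)) - α - 1) * (x : ℂ) ^ (-α') =
      (x : ℂ) ^ (ρ - α - α' + γ - 1) / (x ^ 2) ^ k := by
    rw [← Complex.cpow_add _ _ hx0, ← pow_mul, ← Complex.cpow_natCast (x : ℂ) (2 * k),
      ← Complex.cpow_sub _ _ hx0]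
    congr 1
    ring
  simp only [f1, f2]
  generalize Complex.Gamma (α + α' - γ - ρ + 1) * Complex.Gamma (α + β' - γ - ρ + 1) *
      Complex.Gamma (-β - ρ + 1) / (Complex.Gamma (1 - ρ) *
        Complex.Gamma (α + α' + β' - γ - ρ + 1) * Complex.Gamma (α - β - ρ + 1)) = K
  generalize poch ((α + α' - γ - ρ + 1) / 2) k = p₁
  generalize poch ((α + α' - γ - ρ + 2) / 2) k = p₂
  generalize poch ((α + β' - γ - ρ + 1) / 2) k = p₃
  generalize poch ((α + β' - γ - ρ + 2) / 2) k = p₄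
  generalize poch ((-β - ρ + 1) / 2) k = p₅
  generalize poch ((-β - ρ + 2) / 2) k = p₆
  generalize poch (3 / 2) k = q₀
  generalize poch ((1 - ρ) / 2) k = q₁
  generalize poch ((2 - ρ) / 2) k = q₂
  generalize poch ((α + α' + β' - γ - ρ + 1) / 2) k = q₃
  generalize poch ((α + α' + β' - γ - ρ + 2) / 2) k = q₄
  generalize poch ((α - β - ρ + 1) / 2) k = q₅
  generalize poch ((α - β - ρ + 2) / 2) k = q₆
  have h4 : (4 : ℂ) ^ k ≠ 0 := pow_ne_zero _ (by norm_num)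
  rw [mul_pow, div_pow, mul_pow, ← pow_mul c, pow_succ c]
  calc _ = ε ^ k * (c ^ (2 * k) * c / (4 ^ k * (q₀ * k.factorial))) * K *
        ((4 ^ k * (p₁ * p₂) * (4 ^ k * (p₃ * p₄)) * (4 ^ k * (p₅ * p₆))) /
          (4 ^ k * (q₁ * q₂) * (4 ^ k * (q₃ * q₄)) * (4 ^ k * (q₅ * q₆)))) *
        ((x : ℂ) ^ (γ + (ρ - (2 * k : ℕ)) - α - 1) * (x : ℂ) ^ (-α')) *
        (Complex.Gamma γ / Complex.Gamma γ) := by ring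
    _ = _ := by
        have e : 4 ^ k * (p₁ * p₂) * (4 ^ k * (p₃ * p₄)) * (4 ^ k * (p₅ * p₆)) /
            (4 ^ k * (q₁ * q₂) * (4 ^ k * (q₃ * q₄)) * (4 ^ k * (q₅ * q₆))) =
            p₁ * p₂ * p₃ * p₄ * p₅ * p₆ / (q₁ * q₂ * q₃ * q₄ * q₅ * q₆) := by
          rw [← mul_div_mul_left (p₁ * p₂ * p₃ * p₄ * p₅ * p₆) _ (pow_ne_zero 3 h4)]
          congr 1 <;> ring
        rw [hpow, div_self hΓ, e]
        ring

end

theorem mainTheorem12 (α α' β β' γ ρ c : ℂ) (hγ : 0 < γ.re)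
    (hρ : ρ.re < 1 + min (-β).re (min (α + α' - γ).re (α + β' - γ).re))
    (hden₁ : ∀ n : ℕ, 1 - ρ ≠ -(n : ℂ))
    (hden₂ : ∀ n : ℕ, α + α' + β' - γ - ρ + 1 ≠ -(n : ℂ))
    (hden₃ : ∀ n : ℕ, α - β - ρ + 1 ≠ -(n : ℂ))
    (x : ℝ) (hx : 0 < x) :
    (IntegrableOn
        (msmRightIntegrand α α' β β' γ (fun t => (t : ℂ) ^ ρ * Complex.sin (c / (t : ℂ))) x)
        (Set.Ioi x) ∧
      msmRight α α' β β' γ (fun t => (t : ℂ) ^ ρ * Complex.sin (c / (t : ℂ))) x =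
        c * (Complex.Gamma (α + α' - γ - ρ + 1) * Complex.Gamma (α + β' - γ - ρ + 1) *
            Complex.Gamma (-β - ρ + 1) /
          (Complex.Gamma (1 - ρ) * Complex.Gamma (α + α' + β' - γ - ρ + 1) *
            Complex.Gamma (α - β - ρ + 1))) *
        (x : ℂ) ^ (ρ - α - α' + γ - 1) *
        genHypergeometric
          [(α + α' - γ - ρ + 1) / 2, (α + α' - γ - ρ + 2) / 2,
            (α + β' - γ - ρ + 1) / 2, (α + β' - γ - ρ + 2) / 2,
            (-β - ρ + 1) / 2, (-β - ρ + 2) / 2]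
          [3 / 2, (1 - ρ) / 2, (2 - ρ) / 2,
            (α + α' + β' - γ - ρ + 1) / 2, (α + α' + β' - γ - ρ + 2) / 2,
            (α - β - ρ + 1) / 2, (α - β - ρ + 2) / 2]
          (-(c ^ 2 / (4 * (x : ℂ) ^ 2)))) ∧
    (IntegrableOn
        (msmRightIntegrand α α' β β' γ (fun t => (t : ℂ) ^ ρ * Complex.sinh (c / (t : ℂ))) x)
        (Set.Ioi x) ∧
      msmRight α α' β β' γ (fun t => (t : ℂ) ^ ρ * Complex.sinh (c / (t : ℂ))) x =
        c * (Complex.Gamma (α + α' - γ - ρ + 1) * Complex.Gamma (α + β' - γ - ρ + 1) *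
            Complex.Gamma (-β - ρ + 1) /
          (Complex.Gamma (1 - ρ) * Complex.Gamma (α + α' + β' - γ - ρ + 1) *
            Complex.Gamma (α - β - ρ + 1))) *
        (x : ℂ) ^ (ρ - α - α' + γ - 1) *
        genHypergeometric
          [(α + α' - γ - ρ + 1) / 2, (α + α' - γ - ρ + 2) / 2,
            (α + β' - γ - ρ + 1) / 2, (α + β' - γ - ρ + 2) / 2,
            (-β - ρ + 1) / 2, (-β - ρ + 2) / 2]
          [3 / 2, (1 - ρ) / 2, (2 - ρ) / 2,
            (α + α' + β' - γ - ρ + 1) / 2, (α + α' + β' - γ - ρ + 2) / 2,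
            (α - β - ρ + 1) / 2, (α - β - ρ + 2) / 2]
          (c ^ 2 / (4 * (x : ℂ) ^ 2))) := by
  have hsin := msmRight_odd (S := Complex.sin) c (ε := -1) (by simp)
    (fun z => (Complex.hasSum_sin z).congr_fun fun k => by ring) hγ hρ hden₁ hden₂ hden₃ hx
  have hsinh := msmRight_odd (S := Complex.sinh) c (ε := 1) (by simp)
    (fun z => (Complex.hasSum_sinh z).congr_fun fun k => by ring) hγ hρ hden₁ hden₂ hden₃ hx
  rw [neg_one_mul] at hsin
  rw [one_mul] at hsinh
  exact ⟨hsin, hsinh⟩
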